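/- Let $n\ge 1$, $m\ge 0$, and let $S^n\subset\mathbb R^{n+1}$, $S^m\subset\mathbb R^{m+1}$ be the unit spheres. A $C^2$ map $\eta:S^n\to S^m$ is called a Lawson--Osserman map (LOM) if there is $\theta\in(0,\frac{\pi}{2})$ such that $F(x)=(\cos\theta\cdot x,\ \sin\theta\cdot\eta(x))$, $x\in S^n$, gives an $n$-dimensional minimal submanifold of the unit sphere $S^{m+n+1}\subset\mathbb R^{n+1}\times\mathbb R^{m+1}=\mathbb R^{m+n+2}$. It is called an LOMSE if, in addition, for each $x\in S^n$ all nonzero singular values of the differential $(\eta_*)_x$ are equal. Theorem. Let $\eta:S^n\to S^m$ be an LOMSE. Then there are an integer $p$ with $1\le p\le n$ and a real number $\lambda>0$, independent of the point, such that for every $x\in S^n$ the $n$ singular values of $(\eta_*)_x$ are $\lambda$ with multiplicity $p$ and $0$ with multiplicity $n-p$. Moreover, for every $C^2$ function $\rho:(0,\infty)\to\mathbb R$, the set $$M=\{(rx,\rho(r)\eta(x)) : x\in S^n,\ r\in(0,\infty)\}\subset\mathbb R^{m+n+2}$$ is an $(n+1)$-dimensional minimal submanifold of $\mathbb R^{m+n+2}$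 if and only if for all $r\in(0,\infty)$ $$\frac{\rho_{rr}}{1+\rho_r^2}+\frac{(n-p)\rho_r}{r}+\frac{p\left(\frac{\rho_r}{r}-\frac{\lambda^2\rho}{r^2}\right)}{1+\frac{\lambda^2\rho^2}{r^2}}=0 .$$ -/

import Mathlib

open scoped Manifold ContDiff

noncomputable section

/-- The Euclidean space `ℝ^k`. -/
abbrev Euc (k : ℕ) : Type := EuclideanSpace ℝ (Fin k)

/-- The unit sphere `S^n` in `ℝ^(n+1)`. -/
abbrev Sph (n : ℕ) : Type := Metric.sphere (0 : Euc (n + 1)) 1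

/-- The Euclidean space `ℝ^(m+n+2)`, written as the orthogonal (`ℓ²`) sum of
`ℝ^(n+1)` and `ℝ^(m+1)`. -/
abbrev Ambient (n m : ℕ) : Type := WithLp 2 (Euc (n + 1) × Euc (m + 1))

section Submanifolds

variable {E : Type*} [NormedAddCommGroup E] [InnerProductSpace ℝ E] [FiniteDimensional ℝ E]

/-- The coefficients `g i j = ⟪∂ᵢ f, ∂ⱼ f⟫` of the metric induced by `f` at `u`. -/
def inducedMetric {k : ℕ} (f : Euc k → E) (u : Euc k) : Matrix (Fin k) (Fin k) ℝ :=
  Matrix.of fun i j =>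
    inner ℝ (fderiv ℝ f u (EuclideanSpace.single i 1)) (fderiv ℝ f u (EuclideanSpace.single j 1))

/-- The tangent space at `f u` of a parametrized submanifold `f`, as a linear subspace of `E`. -/
def tangentRange {k : ℕ} (f : Euc k → E) (u : Euc k) : Submodule ℝ E :=
  LinearMap.range (fderiv ℝ f u).toLinearMap

/-- The second fundamental form of an immersion `f` into a submanifold of `E` whose tangent space
at `f u` is `A`: the part of the second derivative of `f` that is tangent to the
ambient submanifold and orthogonal to the tangent space of `f`. -/
def secondFundamentalForm {k : ℕ} (A : Submodule ℝ E) (f : Euc k → E) (u v w : Euc k) : E :=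
  (A ⊓ (tangentRange f u)ᗮ).starProjection (fderiv ℝ (fderiv ℝ f) u v w)

/-- The (unnormalized) mean curvature vector of an immersion `f` into a submanifold of `E` whose
tangent space at `f u` is `A`: the trace of the second fundamental form with respect to the
induced metric. -/
def meanCurvature {k : ℕ} (A : Submodule ℝ E) (f : Euc k → E) (u : Euc k) : E :=
  ∑ i, ∑ j, (inducedMetric f u)⁻¹ i j •
    secondFundamentalForm A f u (EuclideanSpace.single i 1) (EuclideanSpace.single j 1)

/-- `f`, restricted to the open set `U`, is a local `C²` parametrization of the
`k`-dimensional (embedded) submanifold `S`: a `C²` immersion that is a homeomorphism of `U`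
onto a relatively open subset of `S`. -/
structure IsLocalParam {k : ℕ} (S : Set E) (U : Set (Euc k)) (f : Euc k → E) : Prop where
  isOpen : IsOpen U
  contDiffOn : ContDiffOn ℝ 2 f U
  injective_fderiv : ∀ u ∈ U, Function.Injective (fderiv ℝ f u)
  isEmbedding : Topology.IsEmbedding (U.domRestrict f)
  image_eq : ∃ O : Set E, IsOpen O ∧ f '' U = S ∩ O

/-- `S` is a `k`-dimensional `C²` minimal submanifold of the Euclidean space `E`: it is covered
by local parametrizations whose mean curvature vector vanishes. -/
def IsMinimalSubmanifold (k : ℕ) (S : Set E) : Prop :=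
  ∀ q ∈ S, ∃ (U : Set (Euc k)) (f : Euc k → E),
    IsLocalParam S U f ∧ q ∈ f '' U ∧ ∀ u ∈ U, meanCurvature ⊤ f u = 0

/-- `S` is a `k`-dimensional `C²` minimal submanifold of the unit sphere of `E`: it is contained
in that sphere and covered by local parametrizations whose mean curvature vector in the sphere,
the tangent space of which at `q` is the orthogonal complement of `q`, vanishes. -/
def IsMinimalSubmanifoldOfSphere (k : ℕ) (S : Set E) : Prop :=
  S ⊆ Metric.sphere (0 : E) 1 ∧
  ∀ q ∈ S, ∃ (U : Set (Euc k)) (f : Euc k → E),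
    IsLocalParam S U f ∧ q ∈ f '' U ∧ ∀ u ∈ U, meanCurvature (ℝ ∙ f u)ᗮ f u = 0

end Submanifolds

section Spheres

/-- The differential at `x` of the inclusion `S^n → ℝ^(n+1)` identifies the abstract tangent space
with the orthogonal complement of `x`. -/
def sphereTangentEquiv {n : ℕ} (x : Sph n) :
    TangentSpace (𝓡 n) x ≃ₗ[ℝ] ((ℝ ∙ (x : Euc (n + 1)))ᗮ : Submodule ℝ (Euc (n + 1))) :=
  haveI := Fact.mk (@finrank_euclideanSpace_fin ℝ _ (n + 1))
  (LinearEquiv.ofInjective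
      (mvfderiv (𝓡 n) ((↑) : Sph n → Euc (n + 1)) x).toLinearMap
      (injective_mvfderiv_subtypeVal_sphere x)).trans
    (LinearEquiv.ofEq _ _ (range_mvfderiv_subtypeVal x))

/-- The differential of `η : S^n → S^m` at `x`, as a linear map from `T_x S^n = x^⊥ ⊆ ℝ^(n+1)`
to `ℝ^(m+1)` (which contains `T_{η x} S^m`). Both sides carry the Euclidean inner product. -/
def sphereDifferential {n m : ℕ} (η : Sph n → Sph m) (x : Sph n) :
    ((ℝ ∙ (x : Euc (n + 1)))ᗮ : Submodule ℝ (Euc (n + 1))) →ₗ[ℝ] Euc (m + 1) :=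
  (mvfderiv (𝓡 n) (fun y : Sph n => (η y : Euc (m + 1))) x).toLinearMap ∘ₗ
    (sphereTangentEquiv x).symm.toLinearMap

/-- Lawson–Osserman maps: `C²` maps `η : S^n → S^m` such that, for some `θ ∈ (0, π/2)`, the map
`x ↦ (cos θ · x, sin θ · η x)` gives an `n`-dimensional minimal submanifold of `S^(m+n+1)`. -/
def IsLOM {n m : ℕ} (η : Sph n → Sph m) : Prop :=
  ContMDiff (𝓡 n) (𝓡 m) 2 η ∧
  ∃ θ ∈ Set.Ioo (0 : ℝ) (Real.pi / 2),
    IsMinimalSubmanifoldOfSphere n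
      (Set.range fun x : Sph n =>
        (WithLp.toLp 2
          (Real.cos θ • (x : Euc (n + 1)), Real.sin θ • (η x : Euc (m + 1))) : Ambient n m))

/-- LOMSE: a Lawson–Osserman map such that at each point all nonzero singular
values of the differential are equal. -/
def IsLOMSE {n m : ℕ} (η : Sph n → Sph m) : Prop :=
  IsLOM η ∧
  ∀ x : Sph n, ∀ i j : ℕ,
    (sphereDifferential η x).singularValues i ≠ 0 →
    (sphereDifferential η x).singularValues j ≠ 0 →
    (sphereDifferential η x).singularValues i = (sphereDifferential η x).singularValues j

/-- The set `{(r x, ρ(r) η(x)) : x ∈ S^n, r ∈ (0, ∞)}` in `ℝ^(m+n+2)`. -/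
def rotationalSet {n m : ℕ} (ρ : ℝ → ℝ) (η : Sph n → Sph m) : Set (Ambient n m) :=
  {q | ∃ (x : Sph n) (r : ℝ), 0 < r ∧
    q = WithLp.toLp 2 (r • (x : Euc (n + 1)), ρ r • (η x : Euc (m + 1)))}

end Spheres

end

/-! ### Derivatives of degree-zero maps and of their radial rescalings -/

section RadialCalculus

open Filter Topology

variable {E F : Type*} [NormedAddCommGroup E] [NormedAddCommGroup F]

/-! Extend `η` to a map `h` that is homogeneous of degree zero away from the origin. The rotational
set is then the graph of `Φ(y) = ρ(|y|) h(y)`, and the cone over the link is the graph with `ρ(r) =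
tan θ · r`. A graph is minimal exactly when the trace of `D²Φ` with respect to the graph metric
vanishes. At each point `x` of the sphere, diagonalize that metric by an orthonormal frame `v a` of
the complement of `x` whose images `dh (v a)` are orthogonal with squared norms `s a`. Minimality
becomes a vector equation in `h x` and the vectors `D²h (v a, v a)`
(`meanCurvature_rotational_eq_zero_iff`). Minimality of the link gives the same kind of equation
without the radial direction (`meanCurvature_cone_eq_zero_iff`).

Constancy of the singular values: since `|h| = 1`, the `h`-component of `D²h (v, v)` is `-|dh v|²`.
With rank `P` and common singular value `σ`, the `h`-component of the link equation is `n(1 + τ²σ²)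
= Pσ²(1 + τ²)`, where `τ = tan θ`. Hence `P` is a rational function of the continuous energy `Pσ²`,
so it is continuous and integer valued on a connected sphere. Thus `P`, and then `σ`, are constant
(`exists_constant_singularValues`).

Reduction to one scalar equation: put `l = σ²` and `A = dh`. Constancy says `A A* A = l A` on the
whole sphere, an identity that can be differentiated. The derivative shows that `D²h (v, v)` lies in
the range of `A` for a frame vector in the kernel (`sum_inner_smul_of_ker`) and is orthogonal to
that range for the other frame vectors (`inner_fderiv_fderiv_eq_zero`). The link equation therefore
splits: the kernel trace vanishes and the other trace is a multiple of `h`. So for every `ρ` the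
vector equation is a multiple of `h`, and its coefficient is the left side of the ODE
(`sum_weighted_eq_of_link`). -/

lemma ContDiffAt.differentiableAt_fderiv [NormedSpace ℝ E] [NormedSpace ℝ F] {g : E → F} {y : E}
    (hg : ContDiffAt ℝ 2 g y) : DifferentiableAt ℝ (fderiv ℝ g) y :=
  (hg.fderiv_right (m := 1) (by norm_num)).differentiableAt (by norm_num)

lemma hasDerivAt_line [NormedSpace ℝ E] (y v : E) (t : ℝ) :
    HasDerivAt (fun t : ℝ => y + t • v) v t := by
  simpa using ((hasDerivAt_id t).smul_const v).const_add y

lemma hasDerivAt_fderiv_line [NormedSpace ℝ E] [NormedSpace ℝ F] {g : E → F} {y : E} (v : E)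
    (hg : DifferentiableAt ℝ (fderiv ℝ g) y) :
    HasDerivAt (fun t : ℝ => fderiv ℝ g (y + t • v) v) (fderiv ℝ (fderiv ℝ g) y v v) 0 := by
  have h0 : HasFDerivAt (fderiv ℝ g) (fderiv ℝ (fderiv ℝ g) y) (y + (0 : ℝ) • v) := by
    simpa using hg.hasFDerivAt
  have h1 := h0.comp_hasDerivAt (0 : ℝ) (hasDerivAt_line y v 0)
  exact ((ContinuousLinearMap.apply ℝ F v).hasFDerivAt).comp_hasDerivAt (0 : ℝ) h1

/-- The second derivative on the diagonal is the second derivative along a line. -/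
lemma fderiv_fderiv_apply_self_of_line [NormedSpace ℝ E] [NormedSpace ℝ F] {g : E → F} {y v : E}
    (hg : ContDiffAt ℝ 2 g y) {ψ : ℝ → F} {d : F}
    (h₁ : ∀ᶠ t in 𝓝 (0 : ℝ), HasDerivAt (fun t : ℝ => g (y + t • v)) (ψ t) t)
    (h₂ : HasDerivAt ψ d 0) : fderiv ℝ (fderiv ℝ g) y v v = d := by
  have hline : Tendsto (fun t : ℝ => y + t • v) (𝓝 0) (𝓝 y) := by
    have : ContinuousAt (fun t : ℝ => y + t • v) 0 := (hasDerivAt_line y v 0).continuousAt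
    simpa [ContinuousAt] using this
  have hd : ∀ᶠ z in 𝓝 y, DifferentiableAt ℝ g z :=
    (hg.eventually (by norm_num)).mono fun z hz => hz.differentiableAt (by norm_num)
  have hψ : ψ =ᶠ[𝓝 0] fun t => fderiv ℝ g (y + t • v) v := by
    filter_upwards [h₁, hline.eventually hd] with t ht hdt
    exact ht.unique (hdt.hasFDerivAt.comp_hasDerivAt t (hasDerivAt_line y v t))
  have h₄ := hasDerivAt_fderiv_line v hg.differentiableAt_fderiv
  exact (h₂.congr_of_eventuallyEq hψ.symm).unique h₄ |>.symm

lemma hasDerivAt_of_contDiffOn_Ioi {ρ : ℝ → ℝ} (hρ : ContDiffOn ℝ 2 ρ (Set.Ioi 0)) {r : ℝ}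
    (hr : 0 < r) : HasDerivAt ρ (deriv ρ r) r :=
  ((hρ.contDiffAt (Ioi_mem_nhds hr)).differentiableAt (by norm_num)).hasDerivAt

lemma hasDerivAt_deriv_of_contDiffOn_Ioi {ρ : ℝ → ℝ} (hρ : ContDiffOn ℝ 2 ρ (Set.Ioi 0)) {r : ℝ}
    (hr : 0 < r) : HasDerivAt (deriv ρ) (deriv (deriv ρ) r) r :=
  have h := ((hρ.contDiffAt (Ioi_mem_nhds hr)).differentiableAt_fderiv).clm_apply
    (differentiableAt_const (1 : ℝ))
  DifferentiableAt.hasDerivAt h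

variable [InnerProductSpace ℝ E] [InnerProductSpace ℝ F]

/-- A `C²` map to the unit sphere, defined off the origin and homogeneous of degree zero. -/
structure IsRadialExtension (h : E → F) : Prop where
  contDiffAt : ∀ y, y ≠ 0 → ContDiffAt ℝ 2 h y
  map_smul : ∀ r : ℝ, 0 < r → ∀ y, h (r • y) = h y
  norm_eq : ∀ y, y ≠ 0 → ‖h y‖ = 1

namespace IsRadialExtension

variable {h : E → F} (hh : IsRadialExtension h)
include hh

lemma differentiableAt {y : E} (hy : y ≠ 0) : DifferentiableAt ℝ h y :=
  (hh.contDiffAt y hy).differentiableAt (by norm_num)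

lemma hasDerivAt_line {y v : E} {t : ℝ} (hy : y + t • v ≠ 0) :
    HasDerivAt (fun t : ℝ => h (y + t • v)) (fderiv ℝ h (y + t • v) v) t :=
  (hh.differentiableAt hy).hasFDerivAt.comp_hasDerivAt t (_root_.hasDerivAt_line y v t)

lemma hasDerivAt_fderiv_line {y v : E} (hy : y ≠ 0) :
    HasDerivAt (fun t : ℝ => fderiv ℝ h (y + t • v) v) (fderiv ℝ (fderiv ℝ h) y v v) 0 :=
  _root_.hasDerivAt_fderiv_line v (hh.contDiffAt y hy).differentiableAt_fderiv

lemma fderiv_apply_self {y : E} (hy : y ≠ 0) : fderiv ℝ h y y = 0 := by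
  have h1 := hh.hasDerivAt_line (y := y) (v := y) (t := 0) (by simpa using hy)
  have h2 : (fun t : ℝ => h (y + t • y)) =ᶠ[𝓝 0] fun _ => h y := by
    filter_upwards [lt_mem_nhds (show (-1 : ℝ) < 0 by norm_num)] with t ht
    rw [← hh.map_smul (1 + t) (by linarith) y, add_smul, one_smul]
  simpa using (h1.congr_of_eventuallyEq h2.symm).unique (hasDerivAt_const (0 : ℝ) (h y))

lemma inner_fderiv {y : E} (hy : y ≠ 0) (v : E) : inner ℝ (h y) (fderiv ℝ h y v) = 0 := by
  have h1 := (hh.differentiableAt hy).hasFDerivAt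
  have h2 := h1.inner ℝ h1
  have h3 : (fun z => inner ℝ (h z) (h z)) =ᶠ[𝓝 y] fun _ => (1 : ℝ) := by
    filter_upwards [isOpen_ne.mem_nhds hy] with z hz
    rw [real_inner_self_eq_norm_sq, hh.norm_eq z hz, one_pow]
  have h4 := (h2.congr_of_eventuallyEq h3.symm).unique (hasFDerivAt_const (1 : ℝ) y)
  have h5 := DFunLike.congr_fun h4 v
  simpa [real_inner_comm] using h5

lemma fderiv_smul {r : ℝ} (hr : 0 < r) (y : E) : fderiv ℝ h (r • y) = r⁻¹ • fderiv ℝ h y := by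
  have h1 : (fun z => h (r • z)) = h := funext (hh.map_smul r hr)
  have h2 := fderiv_comp_smul (𝕜 := ℝ) (f := h) (x := y) r
  rw [h1] at h2
  rw [h2, smul_smul, inv_mul_cancel₀ hr.ne', one_smul]

lemma fderiv_fderiv_smul {r : ℝ} (hr : 0 < r) (y : E) :
    fderiv ℝ (fderiv ℝ h) (r • y) = (r ^ 2)⁻¹ • fderiv ℝ (fderiv ℝ h) y := by
  have h1 : (fun z => fderiv ℝ h (r • z)) = r⁻¹ • fderiv ℝ h := funext (hh.fderiv_smul hr)
  have h2 := fderiv_comp_smul (𝕜 := ℝ) (f := fderiv ℝ h) (x := y) r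
  rw [h1, congrFun (fderiv_const_smul_field (f := fderiv ℝ h) r⁻¹) y, Pi.smul_apply] at h2
  rw [pow_two, mul_inv, ← smul_smul, h2, smul_smul, inv_mul_cancel₀ hr.ne', one_smul]

/-- Obtained by differentiating `⟪h, dh v⟫ = 0` along the line in direction `v`. This identity turns
the vector equations into scalar ones. -/
lemma inner_fderiv_fderiv {y : E} (hy : y ≠ 0) (v : E) :
    inner ℝ (h y) (fderiv ℝ (fderiv ℝ h) y v v) = -‖fderiv ℝ h y v‖ ^ 2 := by
  have h0 : y + (0 : ℝ) • v ≠ 0 := by simpa using hy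
  have h1 := (hh.hasDerivAt_line h0).inner ℝ (hh.hasDerivAt_fderiv_line (v := v) hy)
  have h3 : (fun t : ℝ => inner ℝ (h (y + t • v)) (fderiv ℝ h (y + t • v) v)) =ᶠ[𝓝 0]
      fun _ => (0 : ℝ) := by
    have hc : ContinuousAt (fun t : ℝ => y + t • v) 0 := (_root_.hasDerivAt_line y v 0).continuousAt
    filter_upwards [hc.eventually (isOpen_ne.mem_nhds h0)] with t ht
    exact hh.inner_fderiv ht v
  have h4 := (h1.congr_of_eventuallyEq h3.symm).unique (hasDerivAt_const (0 : ℝ) (0 : ℝ))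
  simp only [zero_smul, add_zero, real_inner_self_eq_norm_sq] at h4
  linarith

end IsRadialExtension

/-- The map `y ↦ ρ(|y|) h(y)`. -/
noncomputable def radialScaling (ρ : ℝ → ℝ) (h : E → F) (y : E) : F := ρ ‖y‖ • h y

namespace IsRadialExtension

variable {h : E → F} (hh : IsRadialExtension h) {ρ : ℝ → ℝ}

include hh

lemma radialScaling_radial {x : E} (hx : ‖x‖ = 1) {s : ℝ} (hs : 0 < s) :
    radialScaling ρ h (s • x) = ρ s • h x := by
  rw [radialScaling, hh.map_smul s hs, norm_smul, hx, mul_one, Real.norm_of_nonneg hs.le]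

variable (hρ : ContDiffOn ℝ 2 ρ (Set.Ioi 0))
include hρ

lemma contDiffAt_radialScaling {y : E} (hy : y ≠ 0) :
    ContDiffAt ℝ 2 (radialScaling ρ h) y := by
  have h1 : ContDiffAt ℝ 2 (fun z : E => ρ ‖z‖) y :=
    ContDiffAt.comp y (hρ.contDiffAt (Ioi_mem_nhds (norm_pos_iff.2 hy))) (contDiffAt_norm ℝ hy)
  exact h1.smul (hh.contDiffAt y hy)

lemma hasDerivAt_radialScaling_radial {x : E} (hx : ‖x‖ = 1) {r : ℝ} (hr : 0 < r) :
    ∀ᶠ t in 𝓝 (0 : ℝ), HasDerivAt (fun t : ℝ => radialScaling ρ h (r • x + t • x))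
      (deriv ρ (r + t) • h x) t := by
  filter_upwards [lt_mem_nhds (show -r < 0 by linarith)] with t ht
  have h1 : HasDerivAt (fun t => ρ (r + t)) (deriv ρ (r + t)) t :=
    (hasDerivAt_of_contDiffOn_Ioi hρ (r := r + t) (by linarith)).comp_const_add r t
  refine (h1.smul_const (h x)).congr_of_eventuallyEq ?_
  filter_upwards [lt_mem_nhds ht] with s hs
  rw [← add_smul, hh.radialScaling_radial hx (by linarith)]

lemma fderiv_radialScaling_radial {x : E} (hx : ‖x‖ = 1) {r : ℝ} (hr : 0 < r) :
    fderiv ℝ (radialScaling ρ h) (r • x) x = deriv ρ r • h x := by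
  have hx0 : r • x ≠ 0 := smul_ne_zero hr.ne' (by rintro rfl; simp at hx)
  have h0 : r • x + (0 : ℝ) • x ≠ 0 := by simpa using hx0
  have h1 := (hh.hasDerivAt_radialScaling_radial hρ hx hr).self_of_nhds
  have h2 := ((hh.contDiffAt_radialScaling hρ h0).differentiableAt
    (by norm_num)).hasFDerivAt.comp_hasDerivAt (0 : ℝ) (_root_.hasDerivAt_line (r • x) x 0)
  simpa using h2.unique h1

lemma fderiv_fderiv_radialScaling_radial {x : E} (hx : ‖x‖ = 1) {r : ℝ} (hr : 0 < r) :
    fderiv ℝ (fderiv ℝ (radialScaling ρ h)) (r • x) x x = deriv (deriv ρ) r • h x := by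
  have hx0 : r • x ≠ 0 := smul_ne_zero hr.ne' (by rintro rfl; simp at hx)
  refine fderiv_fderiv_apply_self_of_line (hh.contDiffAt_radialScaling hρ hx0)
    (hh.hasDerivAt_radialScaling_radial hρ hx hr) ?_
  have h1 : HasDerivAt (fun t => deriv ρ (r + t)) (deriv (deriv ρ) r) 0 := by
    have := hasDerivAt_deriv_of_contDiffOn_Ioi hρ (r := r + 0) (by linarith)
    simpa using this.comp_const_add r 0
  exact h1.smul_const (h x)

lemma hasDerivAt_radialScaling_tangent {x v : E} (hx : ‖x‖ = 1) (hv : inner ℝ x v = 0) {r : ℝ}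
    (hr : 0 < r) (t : ℝ) : HasDerivAt (fun t : ℝ => radialScaling ρ h (r • x + t • v))
      ((deriv ρ √(r ^ 2 + t ^ 2 * ‖v‖ ^ 2) * (t * (‖v‖ ^ 2 / √(r ^ 2 + t ^ 2 * ‖v‖ ^ 2)))) •
        h (r • x + t • v) +
        ρ √(r ^ 2 + t ^ 2 * ‖v‖ ^ 2) • fderiv ℝ h (r • x + t • v) v) t := by
  have hn : ∀ t : ℝ, ‖r • x + t • v‖ = √(r ^ 2 + t ^ 2 * ‖v‖ ^ 2) := by
    intro t
    rw [eq_comm, Real.sqrt_eq_iff_mul_self_eq (by positivity) (by positivity), ← pow_two,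
      norm_add_sq_real, inner_smul_left, inner_smul_right, hv, norm_smul, norm_smul, hx]
    simp [mul_pow]
  have hpos : ∀ t : ℝ, 0 < r ^ 2 + t ^ 2 * ‖v‖ ^ 2 := fun t => by positivity
  have hne : r • x + t • v ≠ 0 := by
    rw [← norm_pos_iff, hn]; exact Real.sqrt_pos.2 (hpos t)
  have h1 : HasDerivAt (fun t : ℝ => √(r ^ 2 + t ^ 2 * ‖v‖ ^ 2))
      (t * (‖v‖ ^ 2 / √(r ^ 2 + t ^ 2 * ‖v‖ ^ 2))) t := by
    have := (((hasDerivAt_pow 2 t).mul_const (‖v‖ ^ 2)).const_add (r ^ 2)).sqrt (hpos t).ne'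
    convert this using 1
    push_cast
    ring
  have h2 := (hasDerivAt_of_contDiffOn_Ioi hρ (Real.sqrt_pos.2 (hpos t))).comp t h1
  have h3 := h2.smul (hh.hasDerivAt_line hne)
  have h4 : (fun t : ℝ => radialScaling ρ h (r • x + t • v)) =
      fun t => (ρ ∘ fun t : ℝ => √(r ^ 2 + t ^ 2 * ‖v‖ ^ 2)) t • h (r • x + t • v) := by
    funext t
    simp [radialScaling, hn]
  rw [h4, add_comm]
  exact h3

lemma fderiv_radialScaling_tangent {x v : E} (hx : ‖x‖ = 1) (hv : inner ℝ x v = 0) {r : ℝ}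
    (hr : 0 < r) :
    fderiv ℝ (radialScaling ρ h) (r • x) v = (ρ r / r) • fderiv ℝ h x v := by
  have hx0 : r • x ≠ 0 := smul_ne_zero hr.ne' (by rintro rfl; simp at hx)
  have h0 : r • x + (0 : ℝ) • v ≠ 0 := by simpa using hx0
  have h1 := hh.hasDerivAt_radialScaling_tangent hρ hx hv hr 0
  have h2 := ((hh.contDiffAt_radialScaling hρ h0).differentiableAt
    (by norm_num)).hasFDerivAt.comp_hasDerivAt (0 : ℝ) (_root_.hasDerivAt_line (r • x) v 0)
  have h3 := h2.unique h1
  simp [Real.sqrt_sq hr.le, hh.fderiv_smul hr] at h3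
  rw [h3, smul_smul, div_eq_mul_inv]

/-- As `v` is orthogonal to `x`, the norm of `r x + t v` is `√(r² + t²|v|²)`, with first derivative
`0` and second derivative `|v|²/r` at `t = 0`. Hence the cross terms drop out and `ρ` contributes
only through `ρ' / r`. -/
lemma fderiv_fderiv_radialScaling_tangent {x v : E} (hx : ‖x‖ = 1) (hv : inner ℝ x v = 0) {r : ℝ}
    (hr : 0 < r) :
    fderiv ℝ (fderiv ℝ (radialScaling ρ h)) (r • x) v v =
      (deriv ρ r / r * ‖v‖ ^ 2) • h x + (ρ r / r ^ 2) • fderiv ℝ (fderiv ℝ h) x v v := by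
  have hx0 : r • x ≠ 0 := smul_ne_zero hr.ne' (by rintro rfl; simp at hx)
  refine fderiv_fderiv_apply_self_of_line (hh.contDiffAt_radialScaling hρ hx0)
    (Eventually.of_forall (hh.hasDerivAt_radialScaling_tangent hρ hx hv hr)) ?_
  have hpos : 0 < r ^ 2 + (0 : ℝ) ^ 2 * ‖v‖ ^ 2 := by positivity
  have h1 : HasDerivAt (fun t : ℝ => √(r ^ 2 + t ^ 2 * ‖v‖ ^ 2)) 0 0 := by
    have := (((hasDerivAt_pow 2 (0 : ℝ)).mul_const (‖v‖ ^ 2)).const_add (r ^ 2)).sqrt hpos.ne'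
    convert this using 1
    simp
  have hs : √(r ^ 2 + (0 : ℝ) ^ 2 * ‖v‖ ^ 2) = r := by simp [Real.sqrt_sq hr.le]
  have hr' : 0 < √(r ^ 2 + (0 : ℝ) ^ 2 * ‖v‖ ^ 2) := by rwa [hs]
  have h2 := (hasDerivAt_of_contDiffOn_Ioi hρ hr').comp (0 : ℝ) h1
  have h3 := (hasDerivAt_deriv_of_contDiffOn_Ioi hρ hr').comp (0 : ℝ) h1
  have h4 := (h3.mul ((hasDerivAt_id (0 : ℝ)).mul ((hasDerivAt_const (0 : ℝ) (‖v‖ ^ 2)).div h1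
    hr'.ne'))).smul (hh.hasDerivAt_line (y := r • x) (v := v) (t := 0) (by simpa using hx0))
  have h5 := h2.smul (hh.hasDerivAt_fderiv_line (y := r • x) (v := v) hx0)
  have h6 := h4.add h5
  refine HasDerivAt.congr_deriv h6 ?_
  simp [Real.sqrt_sq hr.le, hh.fderiv_fderiv_smul hr, hh.map_smul r hr, smul_smul, div_eq_mul_inv,
    mul_assoc, mul_comm]

end IsRadialExtension

end RadialCalculus

/-! ### Mean curvature of parametrized pieces of graphs -/

section GraphMeanCurvature

open Filter Topology

variable {V : Type*} [NormedAddCommGroup V] [InnerProductSpace ℝ V]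

lemma sum_apply_smul_single {k : ℕ} (w : Euc k) :
    ∑ i, w i • (EuclideanSpace.single i (1 : ℝ) : Euc k) = w := by
  simpa using (EuclideanSpace.basisFun (Fin k) ℝ).sum_repr w

/-- Traces with respect to the induced metric may be computed in an orthonormal frame. -/
lemma sum_inv_inducedMetric_smul {k : ℕ} {G : Type*} [NormedAddCommGroup G] [NormedSpace ℝ G]
    (f : Euc k → V) (u : Euc k) (β : Euc k →L[ℝ] Euc k →L[ℝ] G) (w : Fin k → Euc k)
    (hw : ∀ a b, inner ℝ (fderiv ℝ f u (w a)) (fderiv ℝ f u (w b)) = if a = b then 1 else 0) :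
    ∑ i, ∑ j, (inducedMetric f u)⁻¹ i j •
      β (EuclideanSpace.single i 1) (EuclideanSpace.single j 1) = ∑ a, β (w a) (w a) := by
  set W : Matrix (Fin k) (Fin k) ℝ := Matrix.of fun i a => w a i with hW
  -- The columns of `W` are the frame vectors. If `Wᵀ g W = 1` then `g⁻¹ = W Wᵀ`.
  have h1 : W.transpose * inducedMetric f u * W = 1 := by
    ext a b
    have h2 := hw a b
    rw [← sum_apply_smul_single (w a), ← sum_apply_smul_single (w b)] at h2
    simp only [map_sum, map_smul, sum_inner, inner_sum, inner_smul_left, inner_smul_right] at h2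
    rw [Matrix.one_apply, ← h2, Matrix.mul_apply]
    refine Finset.sum_congr rfl fun j _ => ?_
    rw [Matrix.mul_apply, mul_comm]
    congr 1
  have h2 : inducedMetric f u * (W * W.transpose) = 1 := by
    rw [← Matrix.mul_assoc]
    rw [Matrix.mul_assoc] at h1
    exact mul_eq_one_comm.1 h1
  rw [Matrix.inv_eq_right_inv h2]
  have h3 : ∀ a, β (w a) (w a) = ∑ i, ∑ j, (w a i * w a j) •
      β (EuclideanSpace.single i 1) (EuclideanSpace.single j 1) := by
    intro a
    conv_lhs => rw [← sum_apply_smul_single (w a)]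
    simp only [map_sum, map_smul, _root_.sum_apply, _root_.smul_apply,
      Finset.smul_sum, smul_smul]
    rw [Finset.sum_comm]
    refine Finset.sum_congr rfl fun i _ => Finset.sum_congr rfl fun j _ => ?_
    rw [mul_comm]
  simp only [h3, Matrix.mul_apply, Finset.sum_smul]
  rw [Finset.sum_comm' (s := Finset.univ) (t := fun _ => Finset.univ) (t' := Finset.univ)
    (s' := fun _ => Finset.univ) (by simp)]
  conv_rhs => rw [Finset.sum_comm]
  rw [Finset.sum_comm]
  refine Finset.sum_congr rfl fun i _ => ?_
  conv_rhs => rw [Finset.sum_comm]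
  rfl

lemma meanCurvature_eq_starProjection [FiniteDimensional ℝ V] {k : ℕ} (A : Submodule ℝ V)
    (f : Euc k → V) (u : Euc k) (w : Fin k → Euc k)
    (hw : ∀ a b, inner ℝ (fderiv ℝ f u (w a)) (fderiv ℝ f u (w b)) = if a = b then 1 else 0) :
    meanCurvature A f u = (A ⊓ (tangentRange f u)ᗮ).starProjection
      (∑ a, fderiv ℝ (fderiv ℝ f) u (w a) (w a)) := by
  rw [← sum_inv_inducedMetric_smul f u (fderiv ℝ (fderiv ℝ f) u) w hw]
  simp only [meanCurvature, secondFundamentalForm, map_sum, map_smul]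

variable {n m : ℕ}

abbrev fstAmb (n m : ℕ) : Ambient n m →L[ℝ] Euc (n + 1) := WithLp.fstL 2 ℝ _ _

abbrev sndAmb (n m : ℕ) : Ambient n m →L[ℝ] Euc (m + 1) := WithLp.sndL 2 ℝ _ _

lemma fderiv_clm_comp_apply {E G H : Type*} [NormedAddCommGroup E] [NormedSpace ℝ E]
    [NormedAddCommGroup G] [NormedSpace ℝ G] [NormedAddCommGroup H] [NormedSpace ℝ H]
    (T : G →L[ℝ] H) {f : E → G} {u : E} (hf : DifferentiableAt ℝ f u) (v : E) :
    fderiv ℝ (fun z => T (f z)) u v = T (fderiv ℝ f u v) :=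
  DFunLike.congr_fun (T.hasFDerivAt.comp u hf.hasFDerivAt).fderiv v

lemma fderiv_fderiv_clm_comp_apply {E G H : Type*} [NormedAddCommGroup E] [NormedSpace ℝ E]
    [NormedAddCommGroup G] [NormedSpace ℝ G] [NormedAddCommGroup H] [NormedSpace ℝ H]
    (T : G →L[ℝ] H) {f : E → G} {u : E} (hf : ContDiffAt ℝ 2 f u) (v w : E) :
    fderiv ℝ (fderiv ℝ (fun z => T (f z))) u v w = T (fderiv ℝ (fderiv ℝ f) u v w) := by
  have h1 : fderiv ℝ (fun z => T (f z)) =ᶠ[𝓝 u]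
      fun z => ContinuousLinearMap.compL ℝ E G H T (fderiv ℝ f z) := by
    filter_upwards [hf.eventually (by norm_num)] with z hz
    exact (T.hasFDerivAt.comp z (hz.differentiableAt (by norm_num)).hasFDerivAt).fderiv
  rw [h1.fderiv_eq, fderiv_clm_comp_apply _ hf.differentiableAt_fderiv]
  rfl

/-- The chain rule for second derivatives. -/
lemma fderiv_fderiv_comp_apply {E G H : Type*} [NormedAddCommGroup E] [NormedSpace ℝ E]
    [NormedAddCommGroup G] [NormedSpace ℝ G] [NormedAddCommGroup H] [NormedSpace ℝ H]
    {g : G → H} {f : E → G} {u : E} (hg : ContDiffAt ℝ 2 g (f u)) (hf : ContDiffAt ℝ 2 f u)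
    (v w : E) :
    fderiv ℝ (fderiv ℝ (fun z => g (f z))) u v w =
      fderiv ℝ (fderiv ℝ g) (f u) (fderiv ℝ f u v) (fderiv ℝ f u w) +
        fderiv ℝ g (f u) (fderiv ℝ (fderiv ℝ f) u v w) := by
  have h1 : fderiv ℝ (fun z => g (f z)) =ᶠ[𝓝 u]
      fun z => (fderiv ℝ g (f z)).comp (fderiv ℝ f z) := by
    filter_upwards [hf.eventually (by norm_num),
      hf.continuousAt.eventually (hg.eventually (by norm_num))] with z hz hgz
    exact ((hgz.differentiableAt (by norm_num)).hasFDerivAt.comp z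
      (hz.differentiableAt (by norm_num)).hasFDerivAt).fderiv
  have h2 : HasFDerivAt (fun z => fderiv ℝ g (f z))
      ((fderiv ℝ (fderiv ℝ g) (f u)).comp (fderiv ℝ f u)) u :=
    hg.differentiableAt_fderiv.hasFDerivAt.comp u
      (hf.differentiableAt (by norm_num)).hasFDerivAt
  have h3 := h2.clm_comp hf.differentiableAt_fderiv.hasFDerivAt
  rw [h1.fderiv_eq, h3.fderiv]
  simp [add_comm]

/-- The tangent space of the graph of a map with differential `D`. -/
def graphSubspace (D : Euc (n + 1) →L[ℝ] Euc (m + 1)) : Submodule ℝ (Ambient n m) where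
  carrier := {q | q.snd = D q.fst}
  add_mem' := by
    intro a b ha hb
    simp only [Set.mem_ofPred_eq] at *
    simp [ha, hb]
  zero_mem' := by simp
  smul_mem' := by
    intro c a ha
    simp only [Set.mem_ofPred_eq] at *
    simp [ha]

lemma mem_graphSubspace {D : Euc (n + 1) →L[ℝ] Euc (m + 1)} {q : Ambient n m} :
    q ∈ graphSubspace D ↔ q.snd = D q.fst := Iff.rfl

/-- Points of a parametrized piece of the graph of `Φ`. -/
structure IsGraphParam {k : ℕ} (Φ : Euc (n + 1) → Euc (m + 1)) (f : Euc k → Ambient n m)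
    (u : Euc k) : Prop where
  contDiffAt : ContDiffAt ℝ 2 f u
  contDiffAt_graph : ContDiffAt ℝ 2 Φ (f u).fst
  eventually_snd : ∀ᶠ z in 𝓝 u, (f z).snd = Φ (f z).fst

namespace IsGraphParam

variable {k : ℕ} {Φ : Euc (n + 1) → Euc (m + 1)} {f : Euc k → Ambient n m} {u : Euc k}
  (hf : IsGraphParam Φ f u)
include hf

lemma contDiffAt_fst : ContDiffAt ℝ 2 (fun z => (f z).fst) u :=
  (fstAmb n m).contDiff.contDiffAt.comp u hf.contDiffAt

lemma fderiv_fst (v : Euc k) : fderiv ℝ (fun z => (f z).fst) u v = (fderiv ℝ f u v).fst :=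
  fderiv_clm_comp_apply (fstAmb n m) (hf.contDiffAt.differentiableAt (by norm_num)) v

lemma snd_fderiv (v : Euc k) :
    (fderiv ℝ f u v).snd = fderiv ℝ Φ (f u).fst (fderiv ℝ f u v).fst := by
  have h1 := fderiv_clm_comp_apply (sndAmb n m) (hf.contDiffAt.differentiableAt (by norm_num)) v
  have h2 : (fun z => sndAmb n m (f z)) =ᶠ[𝓝 u] fun z => Φ (f z).fst := hf.eventually_snd
  rw [h2.fderiv_eq] at h1
  refine h1.symm.trans ?_
  rw [← hf.fderiv_fst]
  have := ((hf.contDiffAt_graph.differentiableAt (by norm_num)).hasFDerivAt.comp u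
    (hf.contDiffAt_fst.differentiableAt (by norm_num)).hasFDerivAt).fderiv
  exact DFunLike.congr_fun this v

lemma fderiv_mem_graphSubspace (v : Euc k) :
    fderiv ℝ f u v ∈ graphSubspace (fderiv ℝ Φ (f u).fst) := hf.snd_fderiv v

lemma snd_fderiv_fderiv (v w : Euc k) :
    (fderiv ℝ (fderiv ℝ f) u v w).snd =
      fderiv ℝ (fderiv ℝ Φ) (f u).fst (fderiv ℝ f u v).fst (fderiv ℝ f u w).fst +
        fderiv ℝ Φ (f u).fst (fderiv ℝ (fderiv ℝ f) u v w).fst := by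
  have h1 := fderiv_fderiv_clm_comp_apply (sndAmb n m) hf.contDiffAt v w
  have h2 : (fun z => sndAmb n m (f z)) =ᶠ[𝓝 u] fun z => Φ (f z).fst := hf.eventually_snd
  rw [h2.fderiv.fderiv_eq,
    fderiv_fderiv_comp_apply (f := fun z => (f z).fst) hf.contDiffAt_graph hf.contDiffAt_fst] at h1
  refine h1.symm.trans ?_
  rw [hf.fderiv_fst, hf.fderiv_fst]
  congr 2
  exact fderiv_fderiv_clm_comp_apply (fstAmb n m) hf.contDiffAt v w

/-- If the normal space consists of the vectors orthogonal to the graph of `Φ`, then the mean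
curvature vanishes precisely if the trace of the second derivative of `Φ` does. -/
lemma meanCurvature_eq_zero_iff (A : Submodule ℝ (Ambient n m))
    (hA : A ⊓ (tangentRange f u)ᗮ = (graphSubspace (fderiv ℝ Φ (f u).fst))ᗮ)
    (w : Fin k → Euc k) (e : Fin k → Euc (n + 1))
    (hwe : ∀ a, (fderiv ℝ f u (w a)).fst = e a)
    (he : ∀ a b, inner ℝ (e a) (e b) +
      inner ℝ (fderiv ℝ Φ (f u).fst (e a)) (fderiv ℝ Φ (f u).fst (e b)) = if a = b then 1 else 0) :
    meanCurvature A f u = 0 ↔ ∑ a, fderiv ℝ (fderiv ℝ Φ) (f u).fst (e a) (e a) = 0 := by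
  -- The normal projection of the trace vanishes iff the trace lies in the tangent space of the
  -- graph, that is, iff its second component is `DΦ` of its first. By the chain rule the two differ
  -- by exactly the trace of `D²Φ`.
  rw [meanCurvature_eq_starProjection A f u w, Submodule.starProjection_apply_eq_zero_iff,
    hA, Submodule.orthogonal_orthogonal,
    mem_graphSubspace]
  · rw [← sub_eq_zero]
    have h1 : (∑ a, fderiv ℝ (fderiv ℝ f) u (w a) (w a)).snd =
        ∑ a, (fderiv ℝ (fderiv ℝ f) u (w a) (w a)).snd := map_sum (sndAmb n m) _ _
    have h2 : (∑ a, fderiv ℝ (fderiv ℝ f) u (w a) (w a)).fst =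
        ∑ a, (fderiv ℝ (fderiv ℝ f) u (w a) (w a)).fst := map_sum (fstAmb n m) _ _
    rw [h1, h2, map_sum, ← Finset.sum_sub_distrib]
    simp only [hf.snd_fderiv_fderiv, hwe, add_sub_cancel_right]
  · intro a b
    rw [WithLp.prod_inner_apply]
    have h1 := he a b
    simp only [← hwe, ← hf.snd_fderiv] at h1
    exact h1

end IsGraphParam

end GraphMeanCurvature

/-! ### The minimal surface equations of link and rotational set in an adapted frame -/

section RotationalMeanCurvature

open Filter Topology

variable {n m : ℕ}

/-- An orthonormal frame `v` of `x^⊥`, the image of which under the differential of `h` is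
orthogonal with squared norms `s`. -/
structure IsAdaptedFrame (h : Euc (n + 1) → Euc (m + 1)) (x : Euc (n + 1))
    (v : Fin n → Euc (n + 1)) (s : Fin n → ℝ) : Prop where
  norm_eq : ‖x‖ = 1
  inner_self_frame : ∀ a, inner ℝ x (v a) = 0
  inner_frame : ∀ a b, inner ℝ (v a) (v b) = if a = b then 1 else 0
  inner_fderiv : ∀ a b,
    inner ℝ (fderiv ℝ h x (v a)) (fderiv ℝ h x (v b)) = if a = b then s a else 0

namespace IsAdaptedFrame

variable {h : Euc (n + 1) → Euc (m + 1)} {x : Euc (n + 1)} {v : Fin n → Euc (n + 1)}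
  {s : Fin n → ℝ} (hv : IsAdaptedFrame h x v s)
include hv

lemma ne_zero : x ≠ 0 := by
  rintro rfl
  simpa using hv.norm_eq

lemma norm_frame (a : Fin n) : ‖v a‖ = 1 := by
  have h1 := hv.inner_frame a a
  rw [if_pos rfl, real_inner_self_eq_norm_sq] at h1
  nlinarith [norm_nonneg (v a)]

lemma norm_sq_fderiv (a : Fin n) : ‖fderiv ℝ h x (v a)‖ ^ 2 = s a := by
  rw [← real_inner_self_eq_norm_sq, hv.inner_fderiv, if_pos rfl]

lemma nonneg (a : Fin n) : 0 ≤ s a := by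
  rw [← hv.norm_sq_fderiv]
  positivity

lemma weight_pos (c : ℝ) (a : Fin n) : 0 < 1 + c ^ 2 * s a := by
  have := hv.nonneg a
  positivity

variable (hh : IsRadialExtension h) {ρ : ℝ → ℝ} (hρ : ContDiffOn ℝ 2 ρ (Set.Ioi 0)) {r : ℝ}
  (hr : 0 < r)
include hh hρ hr

/-- Since `DΦ` scales `dh (v a)` by `ρ / r`, the graph metric is diagonal on the frame with entries
`1 + (ρ/r)² s a`; the scaling normalizes it. -/
lemma inner_scaled_tangent (a b : Fin n) :
    inner ℝ ((√(1 + (ρ r / r) ^ 2 * s a))⁻¹ • v a) ((√(1 + (ρ r / r) ^ 2 * s b))⁻¹ • v b) +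
      inner ℝ (fderiv ℝ (radialScaling ρ h) (r • x) ((√(1 + (ρ r / r) ^ 2 * s a))⁻¹ • v a))
        (fderiv ℝ (radialScaling ρ h) (r • x) ((√(1 + (ρ r / r) ^ 2 * s b))⁻¹ • v b)) =
      if a = b then 1 else 0 := by
  simp only [map_smul, inner_smul_left, inner_smul_right, hv.inner_frame,
    hh.fderiv_radialScaling_tangent hρ hv.norm_eq (hv.inner_self_frame _) hr, hv.inner_fderiv]
  split_ifs with hab
  · subst hab
    have h1 := hv.weight_pos (ρ r / r) a
    have h2 := Real.sq_sqrt h1.le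
    have h3 := (Real.sqrt_pos.2 h1).ne'
    simp only [conj_trivial]
    generalize √(1 + (ρ r / r) ^ 2 * s a) = S at *
    generalize ρ r / r = c at *
    field_simp
    linarith
  · simp

lemma fderiv_fderiv_scaled_tangent (a : Fin n) :
    fderiv ℝ (fderiv ℝ (radialScaling ρ h)) (r • x) ((√(1 + (ρ r / r) ^ 2 * s a))⁻¹ • v a)
      ((√(1 + (ρ r / r) ^ 2 * s a))⁻¹ • v a) =
      (1 + (ρ r / r) ^ 2 * s a)⁻¹ • ((deriv ρ r / r) • h x +
        (ρ r / r ^ 2) • fderiv ℝ (fderiv ℝ h) x (v a) (v a)) := by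
  simp only [map_smul, smul_apply]
  rw [hh.fderiv_fderiv_radialScaling_tangent hρ hv.norm_eq (hv.inner_self_frame _) hr,
    hv.norm_frame, smul_smul, ← mul_inv, Real.mul_self_sqrt (hv.weight_pos _ a).le]
  simp

/-- The condition `hcone` makes the position vector `f u` tangent to the graph. The normal space of
the link inside the sphere is then the whole normal space of the graph, and only the `n` spherical
directions enter the trace. -/
lemma meanCurvature_cone_eq_zero_iff {f : Euc n → Ambient n m} {u : Euc n}
    (hf : IsGraphParam (radialScaling ρ h) f u) (hfu : (f u).fst = r • x)
    (hinj : Function.Injective (fderiv ℝ f u)) (hnorm : ∀ᶠ z in 𝓝 u, ‖(f z).fst‖ = r)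
    (hcone : deriv ρ r * r = ρ r) :
    meanCurvature (ℝ ∙ f u)ᗮ f u = 0 ↔
      ∑ a, (1 + (ρ r / r) ^ 2 * s a)⁻¹ • ((deriv ρ r / r) • h x +
        (ρ r / r ^ 2) • fderiv ℝ (fderiv ℝ h) x (v a) (v a)) = 0 := by
  set T : Euc n →ₗ[ℝ] Euc (n + 1) := (fstAmb n m).toLinearMap ∘ₗ (fderiv ℝ f u).toLinearMap
    with hT
  have hTapp : ∀ w, T w = (fderiv ℝ f u w).fst := fun w => rfl
  have hgraph_ext : ∀ q ∈ graphSubspace (fderiv ℝ (radialScaling ρ h) (f u).fst),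
      q.fst = 0 → q = 0 := by
    intro q hq h0
    rw [mem_graphSubspace, h0, map_zero] at hq
    exact WithLp.ofLp_injective 2 (Prod.ext h0 hq)
  have hTinj : Function.Injective T := by
    rw [injective_iff_map_eq_zero]
    intro w hw
    apply hinj
    rw [map_zero]
    exact hgraph_ext _ (hf.fderiv_mem_graphSubspace w) hw
  -- The first component of `f` stays on the sphere of radius `r`, so its differential maps into the
  -- complement of `x`; both spaces have dimension `n`.
  have hTrange : LinearMap.range T = (ℝ ∙ x)ᗮ := by
    apply Submodule.eq_of_le_of_finrank_eq
    · rintro _ ⟨w, rfl⟩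
      rw [Submodule.mem_orthogonal_singleton_iff_inner_right]
      have h1 := (hf.contDiffAt_fst.differentiableAt (by norm_num)).hasFDerivAt
      have h2 := h1.inner ℝ h1
      have h3 : (fun z => inner ℝ (f z).fst (f z).fst) =ᶠ[𝓝 u] fun _ => r ^ 2 := by
        filter_upwards [hnorm] with z hz
        rw [real_inner_self_eq_norm_sq, hz]
      have h4 := (h2.congr_of_eventuallyEq h3.symm).unique (hasFDerivAt_const (r ^ 2) u)
      have h5 := DFunLike.congr_fun h4 w
      have h6 : inner ℝ (r • x) (fderiv ℝ (fun z => (f z).fst) u w) = 0 := by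
        simpa [real_inner_comm, hfu] using h5
      rw [hf.fderiv_fst, inner_smul_left] at h6
      rw [hTapp]
      simpa [hr.ne'] using h6
    · rw [LinearMap.finrank_range_of_inj hTinj]
      have : Fact (Module.finrank ℝ (Euc (n + 1)) = n + 1) := ⟨finrank_euclideanSpace_fin⟩
      rw [Submodule.finrank_orthogonal_span_singleton (n := n) hv.ne_zero,
        finrank_euclideanSpace_fin]
  have hcone_mem : f u ∈ graphSubspace (fderiv ℝ (radialScaling ρ h) (f u).fst) := by
    rw [mem_graphSubspace, hf.eventually_snd.self_of_nhds, hfu, map_smul,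
      hh.fderiv_radialScaling_radial hρ hv.norm_eq hr, smul_smul,
      hh.radialScaling_radial hv.norm_eq hr, mul_comm, hcone]
  have hA : (ℝ ∙ f u)ᗮ ⊓ (tangentRange f u)ᗮ =
      (graphSubspace (fderiv ℝ (radialScaling ρ h) (f u).fst))ᗮ := by
    rw [Submodule.inf_orthogonal]
    congr 1
    apply le_antisymm
    · rw [sup_le_iff, Submodule.span_singleton_le_iff_mem]
      refine ⟨hcone_mem, ?_⟩
      rintro _ ⟨w, rfl⟩
      exact hf.fderiv_mem_graphSubspace w
    · intro q hq
      have h1 : q.fst - inner ℝ x q.fst • x ∈ LinearMap.range T := by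
        rw [hTrange, Submodule.mem_orthogonal_singleton_iff_inner_right, inner_sub_right,
          inner_smul_right, real_inner_self_eq_norm_sq, hv.norm_eq]
        ring
      obtain ⟨w, hw⟩ := h1
      have h2 : q - (inner ℝ x q.fst / r) • f u - fderiv ℝ f u w = 0 := by
        apply hgraph_ext
        · exact Submodule.sub_mem _ (Submodule.sub_mem _ hq (Submodule.smul_mem _ _ hcone_mem))
            (hf.fderiv_mem_graphSubspace w)
        · rw [WithLp.sub_fst, WithLp.sub_fst, WithLp.smul_fst, hfu, ← hTapp, hw, smul_smul,
            div_mul_cancel₀ _ hr.ne']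
          simp
      rw [sub_sub, sub_eq_zero] at h2
      rw [h2]
      exact Submodule.add_mem_sup (Submodule.smul_mem _ _ (Submodule.mem_span_singleton_self _))
        ⟨w, rfl⟩
  have hsurj : ∀ a, ∃ w, T w = (√(1 + (ρ r / r) ^ 2 * s a))⁻¹ • v a := by
    intro a
    rw [← LinearMap.mem_range, hTrange, Submodule.mem_orthogonal_singleton_iff_inner_right,
      inner_smul_right, hv.inner_self_frame, mul_zero]
  choose w hw using hsurj
  rw [hf.meanCurvature_eq_zero_iff _ hA w _ hw, hfu]
  · simp only [hv.fderiv_fderiv_scaled_tangent hh hρ hr]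
  · intro a b
    rw [hfu]
    exact hv.inner_scaled_tangent hh hρ hr a b

lemma meanCurvature_rotational_eq_zero_iff {f : Euc (n + 1) → Ambient n m} {u : Euc (n + 1)}
    (hf : IsGraphParam (radialScaling ρ h) f u) (hfu : (f u).fst = r • x)
    (hinj : Function.Injective (fderiv ℝ f u)) :
    meanCurvature ⊤ f u = 0 ↔
      (deriv (deriv ρ) r / (1 + deriv ρ r ^ 2)) • h x +
      ∑ a, (1 + (ρ r / r) ^ 2 * s a)⁻¹ • ((deriv ρ r / r) • h x +
        (ρ r / r ^ 2) • fderiv ℝ (fderiv ℝ h) x (v a) (v a)) = 0 := by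
  set T : Euc (n + 1) →ₗ[ℝ] Euc (n + 1) :=
    (fstAmb n m).toLinearMap ∘ₗ (fderiv ℝ f u).toLinearMap with hT
  have hTapp : ∀ w, T w = (fderiv ℝ f u w).fst := fun w => rfl
  have hgraph_ext : ∀ q ∈ graphSubspace (fderiv ℝ (radialScaling ρ h) (f u).fst),
      q.fst = 0 → q = 0 := by
    intro q hq h0
    rw [mem_graphSubspace, h0, map_zero] at hq
    exact WithLp.ofLp_injective 2 (Prod.ext h0 hq)
  have hTinj : Function.Injective T := by
    rw [injective_iff_map_eq_zero]
    intro w hw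
    apply hinj
    rw [map_zero]
    exact hgraph_ext _ (hf.fderiv_mem_graphSubspace w) hw
  have hTsurj : Function.Surjective T := LinearMap.injective_iff_surjective.1 hTinj
  have hA : ⊤ ⊓ (tangentRange f u)ᗮ =
      (graphSubspace (fderiv ℝ (radialScaling ρ h) (f u).fst))ᗮ := by
    rw [top_inf_eq]
    congr 1
    apply le_antisymm
    · rintro _ ⟨w, rfl⟩
      exact hf.fderiv_mem_graphSubspace w
    · intro q hq
      obtain ⟨w, hw⟩ := hTsurj q.fst
      have h2 : q - fderiv ℝ f u w = 0 := by
        apply hgraph_ext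
        · exact Submodule.sub_mem _ hq (hf.fderiv_mem_graphSubspace w)
        · rw [WithLp.sub_fst, ← hTapp, hw, sub_self]
      rw [sub_eq_zero] at h2
      rw [h2]
      exact ⟨w, rfl⟩
  have hpos : 0 < 1 + deriv ρ r ^ 2 := by positivity
  -- The radial direction is a further orthogonal one: `DΦ x = ρ' h x` has length `|ρ'|` and is
  -- orthogonal to all `dh (v a)`.
  choose w hw using fun a => hTsurj ((Fin.cons ((√(1 + deriv ρ r ^ 2))⁻¹ • x)
    (fun a => (√(1 + (ρ r / r) ^ 2 * s a))⁻¹ • v a) : Fin (n + 1) → Euc (n + 1)) a)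
  rw [hf.meanCurvature_eq_zero_iff _ hA w _ hw, hfu, Fin.sum_univ_succ]
  · simp only [Fin.cons_zero, Fin.cons_succ, hv.fderiv_fderiv_scaled_tangent hh hρ hr]
    simp only [map_smul, smul_apply]
    rw [hh.fderiv_fderiv_radialScaling_radial hρ hv.norm_eq hr, smul_smul, smul_smul, ← mul_inv,
      Real.mul_self_sqrt hpos.le, inv_mul_eq_div]
  · rw [hfu]
    have h1 : ∀ a, inner ℝ (h x) (fderiv ℝ h x (v a)) = 0 := fun a =>
      hh.inner_fderiv hv.ne_zero (v a)
    have h2 : ∀ a, inner ℝ (fderiv ℝ h x (v a)) (h x) = 0 := fun a => by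
      rw [real_inner_comm, h1]
    have h3 : ∀ a, inner ℝ (v a) x = 0 := fun a => by
      rw [real_inner_comm, hv.inner_self_frame]
    intro a b
    refine Fin.cases ?_ (fun a => ?_) a <;> refine Fin.cases ?_ (fun b => ?_) b
    · have h4 := (Real.sqrt_pos.2 hpos).ne'
      have h5 := Real.sq_sqrt hpos.le
      simp only [Fin.cons_zero, map_smul, inner_smul_left, inner_smul_right,
        hh.fderiv_radialScaling_radial hρ hv.norm_eq hr, real_inner_self_eq_norm_sq,
        hv.norm_eq, hh.norm_eq x hv.ne_zero, conj_trivial, if_pos]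
      field_simp
      rw [h5]
    · simp [inner_smul_left, inner_smul_right, hv.inner_self_frame, h1,
        hh.fderiv_radialScaling_radial hρ hv.norm_eq hr, (Fin.succ_ne_zero _).symm,
        hh.fderiv_radialScaling_tangent hρ hv.norm_eq (hv.inner_self_frame _) hr]
    · simp [inner_smul_left, inner_smul_right, h3, h2,
        hh.fderiv_radialScaling_radial hρ hv.norm_eq hr,
        hh.fderiv_radialScaling_tangent hρ hv.norm_eq (hv.inner_self_frame _) hr]
    · simpa only [Fin.cons_succ, Fin.succ_inj] using hv.inner_scaled_tangent hh hρ hr a b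

end IsAdaptedFrame

end RotationalMeanCurvature

/-! ### Consequences of constant, equal nonzero singular values -/

section EqualSingularValues

open Filter Topology

variable {n m : ℕ}

lemma sum_inner_smul_apply_eq_adjoint {E F ι : Type*} [NormedAddCommGroup E]
    [InnerProductSpace ℝ E] [FiniteDimensional ℝ E] [NormedAddCommGroup F] [InnerProductSpace ℝ F]
    [FiniteDimensional ℝ F] [Fintype ι] (b : OrthonormalBasis ι ℝ E) (L : E →ₗ[ℝ] F) (w : F) :
    ∑ i, inner ℝ w (L (b i)) • L (b i) = L (LinearMap.adjoint L w) := by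
  conv_rhs => rw [← b.sum_repr' (LinearMap.adjoint L w), map_sum]
  refine Finset.sum_congr rfl fun i _ => ?_
  rw [map_smul, LinearMap.adjoint_inner_right, real_inner_comm]

lemma sum_norm_sq_apply_eq_trace {E F ι : Type*} [NormedAddCommGroup E]
    [InnerProductSpace ℝ E] [FiniteDimensional ℝ E] [NormedAddCommGroup F] [InnerProductSpace ℝ F]
    [FiniteDimensional ℝ F] [Fintype ι] (b : OrthonormalBasis ι ℝ E) (L : E →ₗ[ℝ] F) :
    ∑ i, ‖L (b i)‖ ^ 2 = LinearMap.trace ℝ E (LinearMap.adjoint L ∘ₗ L) := by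
  rw [LinearMap.trace_eq_sum_inner _ b]
  refine Finset.sum_congr rfl fun i _ => ?_
  rw [LinearMap.comp_apply, LinearMap.adjoint_inner_right, real_inner_self_eq_norm_sq]

namespace IsAdaptedFrame

variable {h : Euc (n + 1) → Euc (m + 1)} {x : Euc (n + 1)} {v : Fin n → Euc (n + 1)}
  {s : Fin n → ℝ} (hv : IsAdaptedFrame h x v s)
include hv

lemma exists_orthonormalBasis : ∃ b : OrthonormalBasis (Fin (n + 1)) ℝ (Euc (n + 1)),
    b 0 = x ∧ ∀ a : Fin n, b a.succ = v a := by
  set e : Fin (n + 1) → Euc (n + 1) := Fin.cons x v with he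
  have h1 : Orthonormal ℝ e := by
    rw [orthonormal_iff_ite]
    intro i j
    refine Fin.cases ?_ (fun a => ?_) i <;> refine Fin.cases ?_ (fun b => ?_) j
    · simp [he, hv.norm_eq]
    · simp [he, hv.inner_self_frame, (Fin.succ_ne_zero _).symm]
    · simp [he, real_inner_comm, hv.inner_self_frame]
    · simp [he, hv.inner_frame]
  have h2 : Orthonormal ℝ (Set.domRestrict Set.univ e) := h1.comp _ Subtype.val_injective
  obtain ⟨b, hb⟩ := h2.exists_orthonormalBasis_extension_of_card_eq (by simp)
  exact ⟨b, by simp [hb, he], fun a => by simp [hb, he]⟩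

lemma fderiv_eq_zero {a : Fin n} (ha : s a = 0) : fderiv ℝ h x (v a) = 0 := by
  have := hv.norm_sq_fderiv a
  rw [ha] at this
  simpa using this

variable (hh : IsRadialExtension h)
include hh

/-- The sum is a trace, hence independent of the basis. A fixed basis makes its continuity in `x`
visible, while the adapted frame gives its value. -/
lemma sum_norm_sq_fderiv {ι : Type*} [Fintype ι] (b : OrthonormalBasis ι ℝ (Euc (n + 1))) :
    ∑ i, ‖fderiv ℝ h x (b i)‖ ^ 2 = ∑ a, s a := by
  obtain ⟨b', h0, h1⟩ := hv.exists_orthonormalBasis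
  refine ((sum_norm_sq_apply_eq_trace b (fderiv ℝ h x).toLinearMap).trans
    (sum_norm_sq_apply_eq_trace b' (fderiv ℝ h x).toLinearMap).symm).trans ?_
  simp [Fin.sum_univ_succ, h0, h1, hh.fderiv_apply_self hv.ne_zero, hv.norm_sq_fderiv]

/-- A frame-free form of the condition on the singular values. Adapted frames need not vary smoothly
with `x`, but this identity can be differentiated. -/
lemma fderiv_adjoint_fderiv {l : ℝ} (hl : ∀ a, s a = 0 ∨ s a = l) :
    (fderiv ℝ h x).toLinearMap ∘ₗ LinearMap.adjoint (fderiv ℝ h x).toLinearMap ∘ₗ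
      (fderiv ℝ h x).toLinearMap = l • (fderiv ℝ h x).toLinearMap := by
  obtain ⟨b, h0, h1⟩ := hv.exists_orthonormalBasis
  refine b.toBasis.ext fun j => ?_
  rw [LinearMap.comp_apply, LinearMap.comp_apply, ← sum_inner_smul_apply_eq_adjoint b,
    LinearMap.smul_apply, b.coe_toBasis]
  simp only [ContinuousLinearMap.coe_coe]
  rw [Fin.sum_univ_succ]
  simp only [h0, h1, hh.fderiv_apply_self hv.ne_zero, smul_zero, zero_add]
  refine Fin.cases ?_ (fun c => ?_) j
  · simp [h0, hh.fderiv_apply_self hv.ne_zero]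
  · simp only [h1, hv.inner_fderiv, ite_smul, zero_smul, Finset.sum_ite_eq, Finset.mem_univ,
      if_true]
    rcases hl c with hc | hc
    · rw [hv.fderiv_eq_zero hc, smul_zero, smul_zero]
    · rw [hc]

/-- The radial component of the minimality equation. -/
lemma sum_eq_zero_of_link {τ : ℝ}
    (hlink : ∑ a, (1 + τ ^ 2 * s a)⁻¹ • (h x + fderiv ℝ (fderiv ℝ h) x (v a) (v a)) = 0) :
    ∑ a, (1 + τ ^ 2 * s a)⁻¹ * (1 - s a) = 0 := by
  have h1 := congrArg (fun z => inner ℝ (h x) z) hlink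
  simp only [inner_sum, inner_smul_right, inner_add_right, real_inner_self_eq_norm_sq,
    hh.norm_eq x hv.ne_zero, hh.inner_fderiv_fderiv hv.ne_zero, hv.norm_sq_fderiv,
    inner_zero_right] at h1
  rw [← h1]
  exact Finset.sum_congr rfl fun a _ => by ring

end IsAdaptedFrame

/-- The squared singular values of the differential of `h` at points of the unit sphere are
`0` or `l`. -/
def HasSquaredSingularValues (h : Euc (n + 1) → Euc (m + 1)) (l : ℝ) : Prop :=
  ∀ x : Euc (n + 1), ‖x‖ = 1 → ∃ v s, IsAdaptedFrame h x v s ∧ ∀ a, s a = 0 ∨ s a = l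

lemma HasSquaredSingularValues.sum_inner_smul_fderiv {h : Euc (n + 1) → Euc (m + 1)} {l : ℝ}
    (hl : HasSquaredSingularValues h l) (hh : IsRadialExtension h)
    (b : OrthonormalBasis (Fin (n + 1)) ℝ (Euc (n + 1))) {y : Euc (n + 1)} (hy : y ≠ 0)
    (X : Euc (n + 1)) :
    ∑ i, inner ℝ (fderiv ℝ h y X) (fderiv ℝ h y (b i)) • fderiv ℝ h y (b i) =
      (l / ‖y‖ ^ 2) • fderiv ℝ h y X := by
  have hy' : 0 < ‖y‖ := norm_pos_iff.2 hy
  set x := ‖y‖⁻¹ • y with hx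
  have hx1 : ‖x‖ = 1 := by rw [hx, norm_smul, norm_inv, norm_norm, inv_mul_cancel₀ hy'.ne']
  have hyx : y = ‖y‖ • x := by rw [hx, smul_smul, mul_inv_cancel₀ hy'.ne', one_smul]
  obtain ⟨v, s, hv, hs⟩ := hl x hx1
  have h1 := LinearMap.congr_fun (hv.fderiv_adjoint_fderiv hh hs) X
  rw [LinearMap.comp_apply, LinearMap.comp_apply, ← sum_inner_smul_apply_eq_adjoint b] at h1
  simp only [ContinuousLinearMap.coe_coe, LinearMap.smul_apply] at h1
  have h2 : fderiv ℝ h y = ‖y‖⁻¹ • fderiv ℝ h x := by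
    conv_lhs => rw [hyx]
    exact hh.fderiv_smul hy' x
  simp only [h2, smul_apply, inner_smul_left, inner_smul_right, smul_smul, conj_trivial]
  have h3 : ∀ i, ‖y‖⁻¹ * (‖y‖⁻¹ * inner ℝ (fderiv ℝ h x X) (fderiv ℝ h x (b i))) * ‖y‖⁻¹ =
      (‖y‖⁻¹ ^ 3) * inner ℝ (fderiv ℝ h x X) (fderiv ℝ h x (b i)) := fun i => by ring
  simp only [h3, ← smul_smul, ← Finset.smul_sum]
  rw [h1]
  simp only [smul_smul]
  congr 1
  field_simp

/-- The derivative at `t = 0` of `A A* A = (l / |y|²) A` along `y = x + t Z`. The factor `l / |y|²`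
is stationary there because `Z` is orthogonal to `x`. -/
lemma HasSquaredSingularValues.sum_deriv {h : Euc (n + 1) → Euc (m + 1)} {l : ℝ}
    (hl : HasSquaredSingularValues h l) (hh : IsRadialExtension h)
    (b : OrthonormalBasis (Fin (n + 1)) ℝ (Euc (n + 1))) {x : Euc (n + 1)} (hx : ‖x‖ = 1)
    (X Z : Euc (n + 1)) (hZ : inner ℝ x Z = 0) :
    ∑ i, (inner ℝ (fderiv ℝ h x X) (fderiv ℝ h x (b i)) • fderiv ℝ (fderiv ℝ h) x Z (b i) +
      (inner ℝ (fderiv ℝ h x X) (fderiv ℝ (fderiv ℝ h) x Z (b i)) +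
        inner ℝ (fderiv ℝ (fderiv ℝ h) x Z X) (fderiv ℝ h x (b i))) • fderiv ℝ h x (b i)) =
      l • fderiv ℝ (fderiv ℝ h) x Z X := by
  have hx0 : x ≠ 0 := by rintro rfl; simp at hx
  have hne : ∀ t : ℝ, x + t • Z ≠ 0 := by
    intro t h0
    have := congrArg (fun z => inner ℝ x z) h0
    simp [inner_add_right, inner_smul_right, hZ, hx] at this
  have hder : ∀ Y, HasDerivAt (fun t : ℝ => fderiv ℝ h (x + t • Z) Y)
      (fderiv ℝ (fderiv ℝ h) x Z Y) 0 := by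
    intro Y
    have h0 : HasFDerivAt (fderiv ℝ h) (fderiv ℝ (fderiv ℝ h) x) (x + (0 : ℝ) • Z) := by
      simpa using (hh.contDiffAt x hx0).differentiableAt_fderiv.hasFDerivAt
    have h1 := h0.comp_hasDerivAt (0 : ℝ) (hasDerivAt_line x Z 0)
    exact ((ContinuousLinearMap.apply ℝ (Euc (m + 1)) Y).hasFDerivAt).comp_hasDerivAt (0 : ℝ) h1
  have hnorm : ∀ t : ℝ, ‖x + t • Z‖ ^ 2 = 1 + t ^ 2 * ‖Z‖ ^ 2 := by
    intro t
    rw [norm_add_sq_real, inner_smul_right, hZ, norm_smul, hx]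
    simp [mul_pow]
  have h1 : HasDerivAt (fun t : ℝ => l / (1 + t ^ 2 * ‖Z‖ ^ 2)) 0 0 := by
    have := (hasDerivAt_const (0 : ℝ) l).div
      (((hasDerivAt_pow 2 (0 : ℝ)).mul_const (‖Z‖ ^ 2)).const_add 1) (by simp)
    refine HasDerivAt.congr_deriv this ?_
    simp
  have h2 := h1.smul (hder X)
  have h3 := HasDerivAt.fun_sum (u := Finset.univ)
    (fun i (_ : i ∈ Finset.univ) => ((hder X).inner ℝ (hder (b i))).smul (hder (b i)))
  have h4 : (fun t : ℝ => ∑ i, inner ℝ (fderiv ℝ h (x + t • Z) X) (fderiv ℝ h (x + t • Z) (b i)) •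
      fderiv ℝ h (x + t • Z) (b i)) =
      fun t : ℝ => (l / (1 + t ^ 2 * ‖Z‖ ^ 2)) • fderiv ℝ h (x + t • Z) X := by
    funext t
    rw [hl.sum_inner_smul_fderiv hh b (hne t), hnorm]
  have h5 : HasDerivAt (fun t : ℝ => ∑ i, inner ℝ (fderiv ℝ h (x + t • Z) X)
      (fderiv ℝ h (x + t • Z) (b i)) • fderiv ℝ h (x + t • Z) (b i)) _ 0 := h3
  rw [h4] at h5
  simpa using h5.unique h2

namespace IsAdaptedFrame

variable {h : Euc (n + 1) → Euc (m + 1)} {x : Euc (n + 1)} {v : Fin n → Euc (n + 1)}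
  {s : Fin n → ℝ} (hv : IsAdaptedFrame h x v s) (hh : IsRadialExtension h)
  {l : ℝ} (hl : HasSquaredSingularValues h l)
include hv hh hl

lemma sum_deriv_frame (X Z : Euc (n + 1)) (hZ : inner ℝ x Z = 0) :
    ∑ a, (inner ℝ (fderiv ℝ h x X) (fderiv ℝ h x (v a)) • fderiv ℝ (fderiv ℝ h) x Z (v a) +
      (inner ℝ (fderiv ℝ h x X) (fderiv ℝ (fderiv ℝ h) x Z (v a)) +
        inner ℝ (fderiv ℝ (fderiv ℝ h) x Z X) (fderiv ℝ h x (v a))) • fderiv ℝ h x (v a)) =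
      l • fderiv ℝ (fderiv ℝ h) x Z X := by
  obtain ⟨b, h0, h1⟩ := hv.exists_orthonormalBasis
  have h2 := hl.sum_deriv hh b hv.norm_eq X Z hZ
  rw [Fin.sum_univ_succ] at h2
  simpa [h0, h1, hh.fderiv_apply_self hv.ne_zero] using h2

/-- The second derivative in kernel directions lies in the range of the differential. -/
lemma sum_inner_smul_of_ker {c : Fin n} (hc : s c = 0) :
    ∑ a, inner ℝ (fderiv ℝ (fderiv ℝ h) x (v c) (v c)) (fderiv ℝ h x (v a)) •
      fderiv ℝ h x (v a) = l • fderiv ℝ (fderiv ℝ h) x (v c) (v c) := by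
  simpa [hv.fderiv_eq_zero hc] using
    hv.sum_deriv_frame hh hl (v c) (v c) (hv.inner_self_frame c)

/-- Pairing the differentiated identity with `dh (v d)` yields `l` times the sum of the two inner
products, after one term cancels against the right side. -/
lemma inner_fderiv_fderiv_antisymm (hl0 : l ≠ 0) {c d : Fin n} (hc : s c = l) (hd : s d = l)
    (Z : Euc (n + 1)) (hZ : inner ℝ x Z = 0) :
    inner ℝ (fderiv ℝ (fderiv ℝ h) x Z (v c)) (fderiv ℝ h x (v d)) =
      -inner ℝ (fderiv ℝ (fderiv ℝ h) x Z (v d)) (fderiv ℝ h x (v c)) := by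
  have h1 := congrArg (fun z => inner ℝ z (fderiv ℝ h x (v d)))
    (hv.sum_deriv_frame hh hl (v c) Z hZ)
  simp only [sum_inner, inner_add_left, inner_smul_left, conj_trivial, hv.inner_fderiv,
    Finset.sum_add_distrib, ite_mul, zero_mul, mul_ite, mul_zero, Finset.sum_ite_eq,
    Finset.sum_ite_eq', Finset.mem_univ, if_true, hc, hd] at h1
  rw [real_inner_comm (fderiv ℝ (fderiv ℝ h) x Z (v d)) (fderiv ℝ h x (v c))] at h1
  apply mul_left_cancel₀ hl0
  linarith

/-- The second derivative in directions orthogonal to the kernel is orthogonal to the range of the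
differential. -/
lemma inner_fderiv_fderiv_eq_zero (hl0 : l ≠ 0) {c d : Fin n} (hc : s c = l) (hd : s d = l) :
    inner ℝ (fderiv ℝ (fderiv ℝ h) x (v c) (v c)) (fderiv ℝ h x (v d)) = 0 := by
  have hsymm : fderiv ℝ (fderiv ℝ h) x (v c) (v d) = fderiv ℝ (fderiv ℝ h) x (v d) (v c) :=
    ((hh.contDiffAt x hv.ne_zero).isSymmSndFDerivAt (by simp)).eq (v c) (v d)
  -- Antisymmetry turns the pairing into `-⟪D²h (v c, v d), dh (v c)⟫`. By symmetry of `D²h` this is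
  -- zero, from antisymmetry with `Z = v d` and both indices `c`.
  have h1 := hv.inner_fderiv_fderiv_antisymm hh hl hl0 hc hd (v c) (hv.inner_self_frame c)
  have h2 := hv.inner_fderiv_fderiv_antisymm hh hl hl0 hc hc (v d) (hv.inner_self_frame d)
  rw [hsymm] at h1
  linarith

/-- If the cone with slope `τ` over the graph of `h` is minimal, then so are all the partial traces
of the second derivative of `h`. -/
lemma sum_weighted_eq_of_link (hl0 : l ≠ 0) (hs : ∀ a, s a = 0 ∨ s a = l) {τ : ℝ}
    (hlink : ∑ a, (1 + τ ^ 2 * s a)⁻¹ • (h x + fderiv ℝ (fderiv ℝ h) x (v a) (v a)) = 0)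
    (q α β : ℝ) :
    ∑ a, (1 + q ^ 2 * s a)⁻¹ • (α • h x + β • fderiv ℝ (fderiv ℝ h) x (v a) (v a)) =
      (∑ a, (1 + q ^ 2 * s a)⁻¹ * (α - β * s a)) • h x := by
  set D : Fin n → Euc (m + 1) := fun a => fderiv ℝ (fderiv ℝ h) x (v a) (v a) with hD
  have hh0 : ∀ a, inner ℝ (h x) (D a) = -s a := fun a => by
    rw [hD]
    simp only
    rw [hh.inner_fderiv_fderiv hv.ne_zero, hv.norm_sq_fderiv]
  have hw : ∀ {a} (q : ℝ), s a ≠ 0 → (1 + q ^ 2 * s a)⁻¹ = (1 + q ^ 2 * l)⁻¹ := by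
    intro a q ha
    rw [(hs a).resolve_left ha]
  -- `K` is the trace over frame vectors in the kernel of `dh`, `N` the trace over the others. The
  -- weights are `1` on `K` and a common constant on `N`.
  set K := ∑ a with s a = 0, D a with hK
  set N := ∑ a with ¬ s a = 0, D a with hN
  have hsplit : ∀ q : ℝ, ∑ a, (1 + q ^ 2 * s a)⁻¹ • D a = K + (1 + q ^ 2 * l)⁻¹ • N := by
    intro q
    rw [← Finset.sum_filter_add_sum_filter_not Finset.univ (fun a => s a = 0), hN, hK,
      Finset.smul_sum]
    congr 1
    · refine Finset.sum_congr rfl fun a ha => ?_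
      simp [(Finset.mem_filter.1 ha).2]
    · refine Finset.sum_congr rfl fun a ha => ?_
      rw [hw q (Finset.mem_filter.1 ha).2]
  have hlink' : (∑ a, (1 + τ ^ 2 * s a)⁻¹) • h x + (K + (1 + τ ^ 2 * l)⁻¹ • N) = 0 := by
    rw [← hsplit, Finset.sum_smul, ← Finset.sum_add_distrib, ← hlink]
    simp only [smul_add]
    rfl
  -- In the link equation, `h x` and `N` are orthogonal to the range of `dh`; hence so is `K`.
  have hKperp : ∀ d, inner ℝ K (fderiv ℝ h x (v d)) = 0 := by
    intro d
    rcases hs d with hd | hd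
    · rw [hv.fderiv_eq_zero hd, inner_zero_right]
    have hNd : inner ℝ N (fderiv ℝ h x (v d)) = 0 := by
      rw [hN, sum_inner]
      refine Finset.sum_eq_zero fun a ha => ?_
      exact hv.inner_fderiv_fderiv_eq_zero hh hl hl0
        ((hs a).resolve_left (Finset.mem_filter.1 ha).2) hd
    have h1 := congrArg (fun z => inner ℝ z (fderiv ℝ h x (v d))) hlink'
    simpa [inner_add_left, inner_smul_left, hNd, hh.inner_fderiv hv.ne_zero] using h1
  -- `l • K` also lies in the range of `dh`, with coefficients `⟪K, dh (v c)⟫ = 0`.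
  have hK0 : K = 0 := by
    have h1 : l • K = 0 := by
      rw [hK, Finset.smul_sum]
      have h2 : ∀ a ∈ Finset.univ.filter (fun a => s a = 0), l • D a =
          ∑ c, inner ℝ (D a) (fderiv ℝ h x (v c)) • fderiv ℝ h x (v c) := fun a ha =>
        (hv.sum_inner_smul_of_ker hh hl (Finset.mem_filter.1 ha).2).symm
      rw [Finset.sum_congr rfl h2, Finset.sum_comm]
      refine Finset.sum_eq_zero fun c _ => ?_
      rw [← Finset.sum_smul, ← sum_inner, ← hK, hKperp, zero_smul]
    exact (smul_eq_zero.1 h1).resolve_left hl0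
  have hnorm : inner ℝ (h x) (h x) = (1 : ℝ) := by
    rw [real_inner_self_eq_norm_sq, hh.norm_eq x hv.ne_zero, one_pow]
  have hNpar : N = inner ℝ (h x) N • h x := by
    -- The sign of `l` ensures `1 + τ² l ≠ 0`. If no `s a` is nonzero, `l` is unconstrained but `N`
    -- is an empty sum.
    have hl1 : 0 ≤ l ∨ ∀ a, s a = 0 := by
      by_cases h1 : ∀ a, s a = 0
      · exact Or.inr h1
      · push Not at h1
        obtain ⟨a, ha⟩ := h1
        exact Or.inl (((hs a).resolve_left ha) ▸ hv.nonneg a)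
    rcases hl1 with hl1 | hl1
    · have hpos : (1 + τ ^ 2 * l) ≠ 0 := by positivity
      rw [hK0, zero_add] at hlink'
      have h1 : N = (-((1 + τ ^ 2 * l) * ∑ a, (1 + τ ^ 2 * s a)⁻¹)) • h x := by
        have h2 := congrArg (fun z => (1 + τ ^ 2 * l) • z) (eq_neg_of_add_eq_zero_right hlink')
        simpa [smul_smul, mul_inv_cancel₀ hpos, neg_smul] using h2
      rw [h1, inner_smul_right, hnorm, mul_one]
    · have : N = 0 := by
        rw [hN]
        exact Finset.sum_eq_zero fun a ha => absurd (hl1 a) (Finset.mem_filter.1 ha).2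
      simp [this]
  have hpar : ∀ q : ℝ, ∑ a, (1 + q ^ 2 * s a)⁻¹ • D a =
      (∑ a, (1 + q ^ 2 * s a)⁻¹ * (-s a)) • h x := by
    intro q
    have h1 : ∑ a, (1 + q ^ 2 * s a)⁻¹ * (-s a) =
        inner ℝ (h x) (∑ a, (1 + q ^ 2 * s a)⁻¹ • D a) := by
      rw [inner_sum]
      refine Finset.sum_congr rfl fun a _ => ?_
      rw [inner_smul_right, hh0]
    rw [h1, hsplit, hK0, zero_add, inner_smul_right, ← smul_smul, ← hNpar]
  have h1 : ∑ a, (1 + q ^ 2 * s a)⁻¹ * (α - β * s a) =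
      α * ∑ a, (1 + q ^ 2 * s a)⁻¹ + β * ∑ a, (1 + q ^ 2 * s a)⁻¹ * (-s a) := by
    rw [Finset.mul_sum, Finset.mul_sum, ← Finset.sum_add_distrib]
    exact Finset.sum_congr rfl fun a _ => by ring
  rw [h1, add_smul, ← smul_smul β, ← hpar, ← smul_smul, Finset.sum_smul, Finset.smul_sum,
    Finset.smul_sum, ← Finset.sum_add_distrib]
  refine Finset.sum_congr rfl fun a _ => ?_
  rw [smul_add, smul_comm α, smul_comm β]

end IsAdaptedFrame

end EqualSingularValues

/-! ### From maps of spheres to homogeneous extensions -/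

section SphereExtension

open Filter Topology

variable {n m : ℕ}

/-- The radial projection of `ℝ^(n+1)` without the origin onto the unit sphere. -/
noncomputable def radialProjection (y : Euc (n + 1)) (hy : y ≠ 0) : Sph n :=
  ⟨‖y‖⁻¹ • y, by
    rw [mem_sphere_zero_iff_norm, norm_smul, norm_inv, norm_norm,
      inv_mul_cancel₀ (norm_ne_zero_iff.2 hy)]⟩

open Classical in
/-- The extension of a map of spheres that is homogeneous of degree zero. -/
noncomputable def sphereExtension (η : Sph n → Sph m) (y : Euc (n + 1)) : Euc (m + 1) :=
  if hy : y ≠ 0 then η (radialProjection y hy) else 0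

lemma Sph.coe_ne_zero (x : Sph n) : (x : Euc (n + 1)) ≠ 0 := ne_zero_of_mem_unit_sphere x

lemma Sph.norm_coe (x : Sph n) : ‖(x : Euc (n + 1))‖ = 1 := norm_eq_of_mem_sphere x

lemma sphereExtension_coe (η : Sph n → Sph m) (x : Sph n) :
    sphereExtension η x = η x := by
  rw [sphereExtension, dif_pos x.coe_ne_zero]
  congr 2
  ext1
  simp [radialProjection, x.norm_coe]

lemma contDiffAt_sphereExtension {η : Sph n → Sph m} (hη : ContMDiff (𝓡 n) (𝓡 m) 2 η)
    {y : Euc (n + 1)} (hy : y ≠ 0) : ContDiffAt ℝ 2 (sphereExtension η) y := by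
  have : Fact (Module.finrank ℝ (Euc (n + 1)) = n + 1) := ⟨finrank_euclideanSpace_fin⟩
  have : Fact (Module.finrank ℝ (Euc (m + 1)) = m + 1) := ⟨finrank_euclideanSpace_fin⟩
  let U : TopologicalSpace.Opens (Euc (n + 1)) := ⟨{z | z ≠ 0}, isOpen_ne⟩
  have h1 : ContMDiff 𝓘(ℝ, Euc (n + 1)) 𝓘(ℝ, Euc (n + 1)) 2
      (fun z : U => ‖(z : Euc (n + 1))‖⁻¹ • (z : Euc (n + 1))) := by
    intro z
    have hz : (z : Euc (n + 1)) ≠ 0 := z.2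
    have h2 : ContDiffAt ℝ 2 (fun z : Euc (n + 1) => ‖z‖⁻¹ • z) z :=
      ((contDiffAt_norm ℝ hz).inv (norm_ne_zero_iff.2 hz)).smul contDiffAt_id
    exact contMDiffAt_subtype_iff.2 h2.contMDiffAt
  have h3 := h1.codRestrict_sphere (n := n) (fun z => (radialProjection z.1 z.2).2)
  have h4 := (contMDiff_coe_sphere (m := 2) (n := m) (E := Euc (m + 1))).comp (hη.comp h3)
  have h5 : ContMDiffAt 𝓘(ℝ, Euc (n + 1)) 𝓘(ℝ, Euc (m + 1)) 2
      (fun z : U => sphereExtension η z) ⟨y, hy⟩ := by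
    refine (h4 ⟨y, hy⟩).congr_of_eventuallyEq (Eventually.of_forall fun z => ?_)
    exact dif_pos z.2
  exact (contMDiffAt_subtype_iff.1 h5).contDiffAt

lemma isRadialExtension_sphereExtension {η : Sph n → Sph m}
    (hη : ContMDiff (𝓡 n) (𝓡 m) 2 η) : IsRadialExtension (sphereExtension η) where
  contDiffAt y hy := contDiffAt_sphereExtension hη hy
  map_smul r hr y := by
    by_cases hy : y = 0
    · simp [hy]
    · rw [sphereExtension, sphereExtension, dif_pos hy, dif_pos (smul_ne_zero hr.ne' hy)]
      congr 2
      ext1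
      have : ‖y‖ ≠ 0 := norm_ne_zero_iff.2 hy
      simp only [radialProjection, norm_smul, Real.norm_of_nonneg hr.le, smul_smul]
      congr 1
      field_simp
  norm_eq y hy := by
    rw [sphereExtension, dif_pos hy]
    exact Sph.norm_coe _

lemma sphereDifferential_apply {η : Sph n → Sph m} (hη : ContMDiff (𝓡 n) (𝓡 m) 2 η) (x : Sph n)
    (w : ((ℝ ∙ (x : Euc (n + 1)))ᗮ : Submodule ℝ (Euc (n + 1)))) :
    sphereDifferential η x w = fderiv ℝ (sphereExtension η) x w := by
  have : Fact (Module.finrank ℝ (Euc (n + 1)) = n + 1) := ⟨finrank_euclideanSpace_fin⟩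
  obtain ⟨t, rfl⟩ := (sphereTangentEquiv x).surjective w
  have h1 : sphereDifferential η x (sphereTangentEquiv x t) =
      mvfderiv (𝓡 n) (fun y : Sph n => (η y : Euc (m + 1))) x t := by
    simp [sphereDifferential]
  have h2 : ((sphereTangentEquiv x t : _) : Euc (n + 1)) =
      mvfderiv (𝓡 n) ((↑) : Sph n → Euc (n + 1)) x t := rfl
  rw [h1, h2]
  have h3 : (fun y : Sph n => (η y : Euc (m + 1))) = sphereExtension η ∘ ((↑) : Sph n → _) :=
    funext fun y => (sphereExtension_coe η y).symm
  have h4 : MDifferentiableAt 𝓘(ℝ, Euc (n + 1)) 𝓘(ℝ, Euc (m + 1)) (sphereExtension η)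
      (x : Euc (n + 1)) :=
    ((contDiffAt_sphereExtension hη x.coe_ne_zero).differentiableAt
      (by norm_num)).mdifferentiableAt
  have h5 : MDifferentiableAt (𝓡 n) 𝓘(ℝ, Euc (n + 1)) ((↑) : Sph n → Euc (n + 1)) x :=
    ((contMDiff_coe_sphere (m := 1) (n := n) (E := Euc (n + 1))) x).mdifferentiableAt one_ne_zero
  rw [h3]
  have h6 := mfderiv_comp_apply x h4 h5 t
  rw [mfderiv_eq_fderiv] at h6
  exact h6

/-- An orthonormal eigenbasis of `T* T` on the complement of `x` serves, where `T` is the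
differential; its eigenvalues are the squared singular values. -/
lemma exists_isAdaptedFrame {η : Sph n → Sph m} (hη : ContMDiff (𝓡 n) (𝓡 m) 2 η) (x : Sph n) :
    ∃ v : Fin n → Euc (n + 1), IsAdaptedFrame (sphereExtension η) x v
      (fun a => (sphereDifferential η x).singularValues a ^ 2) := by
  have : Fact (Module.finrank ℝ (Euc (n + 1)) = n + 1) := ⟨finrank_euclideanSpace_fin⟩
  set T := sphereDifferential η x with hT
  have hfin : Module.finrank ℝ ((ℝ ∙ (x : Euc (n + 1)))ᗮ : Submodule ℝ (Euc (n + 1))) = n :=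
    Submodule.finrank_orthogonal_span_singleton x.coe_ne_zero
  set b := T.isSymmetric_adjoint_comp_self.eigenvectorBasis hfin with hb
  refine ⟨fun a => b a, x.norm_coe, fun a => ?_, fun a c => ?_, fun a c => ?_⟩
  · exact Submodule.mem_orthogonal_singleton_iff_inner_right.1 (b a).2
  · exact orthonormal_iff_ite.1 b.orthonormal a c
  · rw [← sphereDifferential_apply hη, ← sphereDifferential_apply hη, ← hT,
      ← LinearMap.adjoint_inner_right, ← LinearMap.comp_apply, hb,
      LinearMap.IsSymmetric.apply_eigenvectorBasis, inner_smul_right, ← hb,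
      orthonormal_iff_ite.1 b.orthonormal a c, T.sq_singularValues_fin hfin]
    split_ifs with hac
    · simp [hac]
    · simp

end SphereExtension

/-! ### Minimality criteria, constancy of the singular values, and the theorem -/

section Main

open Filter Topology

variable {n m : ℕ}

/-- The minimality of the link, expressed in an adapted frame. -/
lemma sum_weighted_eq_zero_of_isMinimalSubmanifoldOfSphere {η : Sph n → Sph m}
    (hη : ContMDiff (𝓡 n) (𝓡 m) 2 η) {θ : ℝ} (hθ : θ ∈ Set.Ioo (0 : ℝ) (Real.pi / 2))
    (hmin : IsMinimalSubmanifoldOfSphere n (Set.range fun x : Sph n =>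
        (WithLp.toLp 2
          (Real.cos θ • (x : Euc (n + 1)), Real.sin θ • (η x : Euc (m + 1))) : Ambient n m)))
    (x : Sph n) {v : Fin n → Euc (n + 1)} {s : Fin n → ℝ}
    (hv : IsAdaptedFrame (sphereExtension η) x v s) :
    ∑ a, (1 + Real.tan θ ^ 2 * s a)⁻¹ • (sphereExtension η x +
      fderiv ℝ (fderiv ℝ (sphereExtension η)) x (v a) (v a)) = 0 := by
  have hh := isRadialExtension_sphereExtension hη
  have hcos : 0 < Real.cos θ := Real.cos_pos_of_mem_Ioo ⟨by linarith [hθ.1, Real.pi_pos], hθ.2⟩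
  have hsin : 0 < Real.sin θ :=
    Real.sin_pos_of_pos_of_lt_pi hθ.1 (by linarith [hθ.2, Real.pi_pos])
  have htan : Real.tan θ * Real.cos θ = Real.sin θ := Real.tan_mul_cos hcos.ne'
  have htan0 : Real.tan θ ≠ 0 := fun h => by rw [h, zero_mul] at htan; exact hsin.ne htan
  -- With this `ρ` the graph is the cone over the link, which sits at radius `r = cos θ`.
  set ρ : ℝ → ℝ := fun r => Real.tan θ * r with hρdef
  have hρ : ContDiffOn ℝ 2 ρ (Set.Ioi 0) := (contDiff_const.mul contDiff_id).contDiffOn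
  have hder : ∀ r, deriv ρ r = Real.tan θ := fun r =>
    ((hasDerivAt_id r).const_mul (Real.tan θ)).deriv.trans (mul_one _)
  obtain ⟨U, f, hf, ⟨u, hu, hfu⟩, hH⟩ := hmin.2 _ ⟨x, rfl⟩
  have hUu : U ∈ 𝓝 u := hf.isOpen.mem_nhds hu
  have hmem : ∀ z ∈ U, ∃ y : Sph n, WithLp.toLp 2
      (Real.cos θ • (y : Euc (n + 1)), Real.sin θ • (η y : Euc (m + 1))) = f z := by
    intro z hz
    obtain ⟨O, -, hO⟩ := hf.image_eq
    have : f z ∈ f '' U := ⟨z, hz, rfl⟩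
    rw [hO] at this
    exact this.1
  have hfst : (f u).fst = Real.cos θ • (x : Euc (n + 1)) := by rw [hfu]; rfl
  have hgraph : IsGraphParam (radialScaling ρ (sphereExtension η)) f u := by
    refine ⟨hf.contDiffOn.contDiffAt hUu, ?_, ?_⟩
    · rw [hfst]
      exact hh.contDiffAt_radialScaling hρ (smul_ne_zero hcos.ne' x.coe_ne_zero)
    · filter_upwards [hUu] with z hz
      obtain ⟨y, hy⟩ := hmem z hz
      rw [← hy]
      change Real.sin θ • (η y : Euc (m + 1)) =
        radialScaling ρ (sphereExtension η) (Real.cos θ • (y : Euc (n + 1)))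
      rw [hh.radialScaling_radial y.norm_coe hcos, sphereExtension_coe, hρdef]
      simp only [htan]
  have hnorm : ∀ᶠ z in 𝓝 u, ‖(f z).fst‖ = Real.cos θ := by
    filter_upwards [hUu] with z hz
    obtain ⟨y, hy⟩ := hmem z hz
    rw [← hy]
    change ‖Real.cos θ • (y : Euc (n + 1))‖ = Real.cos θ
    rw [norm_smul, y.norm_coe, mul_one, Real.norm_of_nonneg hcos.le]
  have h1 := (hv.meanCurvature_cone_eq_zero_iff hh hρ hcos hgraph hfst
    (hf.injective_fderiv u hu) hnorm (by rw [hder])).1 (hH u hu)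
  have h2 : ρ (Real.cos θ) / Real.cos θ = Real.tan θ := mul_div_cancel_right₀ _ hcos.ne'
  have h3 : ρ (Real.cos θ) / Real.cos θ ^ 2 = Real.tan θ / Real.cos θ := by
    rw [pow_two, ← div_div, h2]
  simp only [h2, h3, hder, ← smul_add] at h1
  simp only [smul_comm _ (Real.tan θ / Real.cos θ), ← Finset.smul_sum] at h1
  exact (smul_eq_zero.1 h1).resolve_left (div_ne_zero htan0 hcos.ne')

/-- The rotational set is minimal precisely if the minimal surface system holds in adapted
frames. -/
lemma isMinimalSubmanifold_rotationalSet_iff {η : Sph n → Sph m}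
    (hη : ContMDiff (𝓡 n) (𝓡 m) 2 η) {v : Sph n → Fin n → Euc (n + 1)} {s : Sph n → Fin n → ℝ}
    (hv : ∀ x : Sph n, IsAdaptedFrame (sphereExtension η) x (v x) (s x))
    {ρ : ℝ → ℝ} (hρ : ContDiffOn ℝ 2 ρ (Set.Ioi 0)) :
    IsMinimalSubmanifold (n + 1) (rotationalSet ρ η) ↔ ∀ (x : Sph n) (r : ℝ), 0 < r →
      (deriv (deriv ρ) r / (1 + deriv ρ r ^ 2)) • sphereExtension η x +
      ∑ a, (1 + (ρ r / r) ^ 2 * s x a)⁻¹ • ((deriv ρ r / r) • sphereExtension η x +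
        (ρ r / r ^ 2) •
          fderiv ℝ (fderiv ℝ (sphereExtension η)) x (v x a) (v x a)) = 0 := by
  have hh := isRadialExtension_sphereExtension hη
  have hval : ∀ (x : Sph n) (r : ℝ), 0 < r →
      radialScaling ρ (sphereExtension η) (r • (x : Euc (n + 1))) = ρ r • (η x : Euc (m + 1)) :=
    fun x r hr => by rw [hh.radialScaling_radial x.norm_coe hr, sphereExtension_coe]
  constructor
  · intro hmin x r hr
    obtain ⟨U, f, hf, ⟨u, hu, hfu⟩, hH⟩ := hmin _ ⟨x, r, hr, rfl⟩
    have hUu : U ∈ 𝓝 u := hf.isOpen.mem_nhds hu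
    have hfst : (f u).fst = r • (x : Euc (n + 1)) := by rw [hfu]; rfl
    have hgraph : IsGraphParam (radialScaling ρ (sphereExtension η)) f u := by
      refine ⟨hf.contDiffOn.contDiffAt hUu, ?_, ?_⟩
      · rw [hfst]
        exact hh.contDiffAt_radialScaling hρ (smul_ne_zero hr.ne' x.coe_ne_zero)
      · filter_upwards [hUu] with z hz
        obtain ⟨O, -, hO⟩ := hf.image_eq
        have hz' : f z ∈ f '' U := ⟨z, hz, rfl⟩
        rw [hO] at hz'
        obtain ⟨y, t, ht, hy⟩ := hz'.1
        rw [hy]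
        exact (hval y t ht).symm
    exact ((hv x).meanCurvature_rotational_eq_zero_iff hh hρ hr hgraph hfst
      (hf.injective_fderiv u hu)).1 (hH u hu)
  · intro hsys
    set Φ := radialScaling ρ (sphereExtension η) with hΦ
    set f : Euc (n + 1) → Ambient n m := fun y => WithLp.toLp 2 (y, Φ y) with hf
    have hΦ2 : ∀ y : Euc (n + 1), y ≠ 0 → ContDiffAt ℝ 2 Φ y := fun y hy =>
      hh.contDiffAt_radialScaling hρ hy
    have hf2 : ∀ y : Euc (n + 1), y ≠ 0 → ContDiffAt ℝ 2 f y := fun y hy =>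
      (WithLp.prodContinuousLinearEquiv 2 ℝ (Euc (n + 1)) (Euc (m + 1))).symm.contDiff.contDiffAt.comp
        y (contDiffAt_id.prodMk (hΦ2 y hy))
    have hgraph : ∀ y : Euc (n + 1), y ≠ 0 → IsGraphParam Φ f y := fun y hy =>
      ⟨hf2 y hy, hΦ2 y hy, Eventually.of_forall fun z => rfl⟩
    have hinj : ∀ y : Euc (n + 1), y ≠ 0 → Function.Injective (fderiv ℝ f y) := by
      intro y hy
      have h1 : ∀ w, (fderiv ℝ f y w).fst = w := fun w => by
        rw [← (hgraph y hy).fderiv_fst]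
        exact DFunLike.congr_fun (fderiv_id (𝕜 := ℝ) (x := y)) w
      intro w w' hw
      rw [← h1 w, hw, h1]
    have hpolar : ∀ y : Euc (n + 1), (hy : y ≠ 0) →
        y = ‖y‖ • (radialProjection y hy : Euc (n + 1)) := fun y hy => by
      rw [radialProjection, smul_smul, mul_inv_cancel₀ (norm_ne_zero_iff.2 hy), one_smul]
    have himage : f '' {y | y ≠ 0} = rotationalSet ρ η := by
      ext q
      constructor
      · rintro ⟨y, hy, rfl⟩
        refine ⟨radialProjection y hy, ‖y‖, norm_pos_iff.2 hy, ?_⟩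
        rw [← hval _ _ (norm_pos_iff.2 hy), ← hpolar]
      · rintro ⟨x, r, hr, rfl⟩
        refine ⟨r • (x : Euc (n + 1)), smul_ne_zero hr.ne' x.coe_ne_zero, ?_⟩
        rw [← hval x r hr]
    intro q hq
    refine ⟨{y | y ≠ 0}, f, ⟨isOpen_ne, fun y hy => (hf2 y hy).contDiffWithinAt,
      fun y hy => hinj y hy, ?_, Set.univ, isOpen_univ, by rw [himage, Set.inter_univ]⟩,
      by rwa [himage], ?_⟩
    · have hcont : Continuous ((({y | y ≠ 0} : Set (Euc (n + 1)))).domRestrict f) :=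
        continuous_iff_continuousAt.2 fun y =>
          ((hf2 y y.2).continuousAt).comp continuous_subtype_val.continuousAt
      -- Projection to the first factor inverts the graph map.
      refine Topology.IsEmbedding.of_comp hcont (fstAmb n m).continuous ?_
      exact Topology.IsEmbedding.subtypeVal
    · intro y hy
      have hy0 := norm_pos_iff.2 hy
      refine ((hv (radialProjection y hy)).meanCurvature_rotational_eq_zero_iff hh hρ hy0
        (hgraph y hy) (hpolar y hy) (hinj y hy)).2 (hsys _ _ hy0)

lemma sum_fin_ite_lt (g : ℝ → ℝ) {p : ℕ} (hp : p ≤ n) (l : ℝ) :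
    ∑ a : Fin n, g (if (a : ℕ) < p then l else 0) = p * g l + ((n : ℝ) - p) * g 0 := by
  have h1 : ∀ a ∈ Finset.range p, g (if a < p then l else 0) = g l := fun a ha => by
    rw [if_pos (Finset.mem_range.1 ha)]
  have h2 : ∀ a ∈ Finset.Ico p n, g (if a < p then l else 0) = g 0 := fun a ha => by
    rw [if_neg (not_lt.2 (Finset.mem_Ico.1 ha).1)]
  rw [Fin.sum_univ_eq_sum_range (fun a => g (if a < p then l else 0)) n,
    ← Finset.sum_range_add_sum_Ico _ hp,
    Finset.sum_congr rfl h1, Finset.sum_congr rfl h2]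
  simp [Nat.cast_sub hp]

lemma continuous_sum_norm_sq_fderiv {h : Euc (n + 1) → Euc (m + 1)} (hh : IsRadialExtension h)
    {ι : Type*} [Fintype ι] (b : ι → Euc (n + 1)) :
    Continuous fun x : Sph n => ∑ i, ‖fderiv ℝ h x (b i)‖ ^ 2 := by
  have h1 : Continuous fun x : Sph n => fderiv ℝ h x := continuous_iff_continuousAt.2 fun x =>
    ((hh.contDiffAt x x.coe_ne_zero).continuousAt_fderiv (by norm_num)).comp
      continuous_subtype_val.continuousAt
  exact continuous_finsetSum _ fun i _ => ((h1.clm_apply continuous_const).norm).pow 2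

/-- The singular values are constant. -/
lemma exists_constant_singularValues (hn : 0 < n) {η : Sph n → Sph m}
    (hη : ContMDiff (𝓡 n) (𝓡 m) 2 η) {τ : ℝ} (hτ : τ ≠ 0)
    (hsing : ∀ x : Sph n, ∀ i j : ℕ,
      (sphereDifferential η x).singularValues i ≠ 0 →
      (sphereDifferential η x).singularValues j ≠ 0 →
      (sphereDifferential η x).singularValues i = (sphereDifferential η x).singularValues j)
    (hlink : ∀ (x : Sph n) (v : Fin n → Euc (n + 1)) (s : Fin n → ℝ),
      IsAdaptedFrame (sphereExtension η) x v s →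
      ∑ a, (1 + τ ^ 2 * s a)⁻¹ • (sphereExtension η x +
        fderiv ℝ (fderiv ℝ (sphereExtension η)) x (v a) (v a)) = 0) :
    ∃ (p : ℕ) (lam : ℝ), 0 < p ∧ p ≤ n ∧ 0 < lam ∧ ∀ (x : Sph n) (i : ℕ),
      (sphereDifferential η x).singularValues i = if i < p then lam else 0 := by
  have hn' : (0 : ℝ) < n := Nat.cast_pos.2 hn
  have hτ2 : 0 < τ ^ 2 := by positivity
  have : Fact (Module.finrank ℝ (Euc (n + 1)) = n + 1) := ⟨finrank_euclideanSpace_fin⟩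
  have hh := isRadialExtension_sphereExtension hη
  set P : Sph n → ℕ := fun x => Module.finrank ℝ (LinearMap.range (sphereDifferential η x))
    with hP
  set σ : Sph n → ℝ := fun x => (sphereDifferential η x).singularValues 0 with hσ
  have hPn : ∀ x, P x ≤ n := fun x => by
    refine (LinearMap.finrank_range_le _).trans_eq ?_
    exact Submodule.finrank_orthogonal_span_singleton x.coe_ne_zero
  have hσP : ∀ x i, (sphereDifferential η x).singularValues i = if i < P x then σ x else 0 := by
    intro x i
    have hiff := fun i => (sphereDifferential η x).singularValues_pos_iff_lt_finrank_range (n := i)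
    split_ifs with hi
    · exact hsing x i 0 ((hiff i).2 hi).ne' ((hiff 0).2 ((Nat.zero_le i).trans_lt hi)).ne'
    · exact le_antisymm (not_lt.1 fun h => hi ((hiff i).1 h))
        ((sphereDifferential η x).singularValues_nonneg i)
  have hσsq : ∀ x, (fun a : Fin n => (sphereDifferential η x).singularValues a ^ 2) =
      fun a : Fin n => if (a : ℕ) < P x then σ x ^ 2 else 0 := fun x => by
    funext a
    rw [hσP]
    split_ifs <;> simp
  have hscalar : ∀ x, (P x : ℝ) * ((1 + τ ^ 2 * σ x ^ 2)⁻¹ * (1 - σ x ^ 2)) + (n - P x) = 0 := by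
    intro x
    obtain ⟨v, hv⟩ := exists_isAdaptedFrame hη x
    rw [hσsq] at hv
    have h1 := hv.sum_eq_zero_of_link hh (hlink x v _ hv)
    rw [sum_fin_ite_lt (fun s => (1 + τ ^ 2 * s)⁻¹ * (1 - s)) (hPn x)] at h1
    simpa using h1
  -- Rank zero would turn the scalar link equation into `n = 0`.
  have hPpos : ∀ x, 0 < P x := fun x => Nat.pos_of_ne_zero fun h => by
    have h1 := hscalar x
    rw [h] at h1
    simp at h1
    omega
  have hσpos : ∀ x, 0 < σ x := fun x =>
    (sphereDifferential η x).singularValues_pos_iff_lt_finrank_range.2 (hPpos x)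
  have hscalar' : ∀ x, (n : ℝ) * (1 + τ ^ 2 * σ x ^ 2) = P x * σ x ^ 2 * (1 + τ ^ 2) := by
    intro x
    have h1 := hscalar x
    have h2 : 1 + τ ^ 2 * σ x ^ 2 ≠ 0 := by positivity
    field_simp at h1
    linarith
  set b := EuclideanSpace.basisFun (Fin (n + 1)) ℝ with hb
  set H : Sph n → ℝ := fun x => ∑ i, ‖fderiv ℝ (sphereExtension η) x (b i)‖ ^ 2 with hH
  have hHP : ∀ x, H x = P x * σ x ^ 2 := by
    intro x
    obtain ⟨v, hv⟩ := exists_isAdaptedFrame hη x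
    rw [hσsq] at hv
    rw [hH]
    simp only
    rw [hv.sum_norm_sq_fderiv hh b, sum_fin_ite_lt (fun s => s) (hPn x)]
    simp
  have hσH : ∀ x, H x * (1 + τ ^ 2) - n = n * τ ^ 2 * σ x ^ 2 := by
    intro x
    rw [hHP, ← hscalar']
    ring
  have hden : ∀ x, H x * (1 + τ ^ 2) - n ≠ 0 := fun x => by
    rw [hσH]
    have := hσpos x
    positivity
  -- Eliminating `σ²` between `H = P σ²` and the scalar link equation expresses the rank through the
  -- energy alone.
  have hPH : ∀ x, (P x : ℝ) = H x * (n * τ ^ 2) / (H x * (1 + τ ^ 2) - n) := by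
    intro x
    rw [eq_div_iff (hden x), hσH, hHP]
    ring
  have hHcont : Continuous H := continuous_sum_norm_sq_fderiv hh b
  have hPcont : Continuous P := by
    rw [Nat.isClosedEmbedding_coe_real.isEmbedding.continuous_iff]
    have h1 : (Nat.cast : ℕ → ℝ) ∘ P =
        fun x => H x * (n * τ ^ 2) / (H x * (1 + τ ^ 2) - n) := funext hPH
    rw [h1]
    exact (hHcont.mul continuous_const).div
      ((hHcont.mul continuous_const).sub continuous_const) hden
  have hconn : PreconnectedSpace (Sph n) := by
    refine Subtype.preconnectedSpace (isPreconnected_sphere ?_ 0 1)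
    rw [← Module.finrank_eq_rank, finrank_euclideanSpace_fin]
    exact_mod_cast (by omega : 1 < n + 1)
  obtain ⟨x₀⟩ : Nonempty (Sph n) :=
    ⟨⟨EuclideanSpace.single 0 1, by simp⟩⟩
  have hPconst : ∀ x, P x = P x₀ := fun x => hconn.constant hPcont
  have hσconst : ∀ x, σ x = σ x₀ := by
    intro x
    have h1 := hscalar' x
    have h2 := hscalar' x₀
    rw [hPconst x] at h1
    -- With `P` constant, the scalar link equation is linear in `σ²` with leading coefficient `c`,
    -- and `n ≠ 0` forces `c ≠ 0`.
    set c : ℝ := P x₀ * (1 + τ ^ 2) - n * τ ^ 2 with hc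
    have h3 : c * σ x ^ 2 = n := by rw [hc]; linarith
    have h4 : c * σ x₀ ^ 2 = n := by rw [hc]; linarith
    have hc0 : c ≠ 0 := fun h => by rw [h, zero_mul] at h3; exact hn'.ne h3
    have h5 := mul_left_cancel₀ hc0 (h3.trans h4.symm)
    exact (pow_left_inj₀ (hσpos x).le (hσpos x₀).le two_ne_zero).1 h5
  refine ⟨P x₀, σ x₀, hPpos x₀, hPn x₀, hσpos x₀, fun x i => ?_⟩
  rw [hσP, hPconst, hσconst]

end Main

theorem theorem3 {n m : ℕ} (hn : 0 < n) (η : Sph n → Sph m) (hη : IsLOMSE η) :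
    ∃ (p : ℕ) (lam : ℝ), 0 < p ∧ p ≤ n ∧ 0 < lam ∧
      (∀ (x : Sph n) (i : ℕ),
        (sphereDifferential η x).singularValues i = if i < p then lam else 0) ∧
      ∀ ρ : ℝ → ℝ, ContDiffOn ℝ 2 ρ (Set.Ioi 0) →
        (IsMinimalSubmanifold (n + 1) (rotationalSet ρ η) ↔
          ∀ r : ℝ, 0 < r →
            deriv (deriv ρ) r / (1 + deriv ρ r ^ 2)
              + ((n : ℝ) - (p : ℝ)) * deriv ρ r / r
              + (p : ℝ) * (deriv ρ r / r - lam ^ 2 * ρ r / r ^ 2)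
                  / (1 + lam ^ 2 * ρ r ^ 2 / r ^ 2) = 0) := by
  obtain ⟨⟨hC, θ, hθ, hmin⟩, hsing⟩ := hη
  have hh := isRadialExtension_sphereExtension hC
  have hlink := fun (x : Sph n) (v : Fin n → Euc (n + 1)) (s : Fin n → ℝ)
    (hv : IsAdaptedFrame (sphereExtension η) x v s) =>
    sum_weighted_eq_zero_of_isMinimalSubmanifoldOfSphere hC hθ hmin x hv
  have hτ : Real.tan θ ≠ 0 := (Real.tan_pos_of_pos_of_lt_pi_div_two hθ.1 hθ.2).ne'
  obtain ⟨p, lam, hp, hpn, hlam, hval⟩ := exists_constant_singularValues hn hC hτ hsing hlink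
  refine ⟨p, lam, hp, hpn, hlam, hval, fun ρ hρ => ?_⟩
  have hframe : ∀ x : Sph n, ∃ v : Fin n → Euc (n + 1), IsAdaptedFrame (sphereExtension η) x v
      (fun a => if (a : ℕ) < p then lam ^ 2 else 0) := by
    intro x
    obtain ⟨v, hv⟩ := exists_isAdaptedFrame hC x
    refine ⟨v, ?_⟩
    convert hv using 2 with a
    rw [hval]
    split_ifs <;> simp
  choose v hv using hframe
  have hs : ∀ a : Fin n, (if (a : ℕ) < p then lam ^ 2 else 0) = 0 ∨
      (if (a : ℕ) < p then lam ^ 2 else 0) = lam ^ 2 := fun a => by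
    split_ifs <;> simp
  have hl : HasSquaredSingularValues (sphereExtension η) (lam ^ 2) := fun x hx =>
    ⟨_, _, hv ⟨x, mem_sphere_zero_iff_norm.2 hx⟩, hs⟩
  have hl0 : lam ^ 2 ≠ 0 := by positivity
  rw [isMinimalSubmanifold_rotationalSet_iff hC hv hρ]
  obtain ⟨x₀⟩ : Nonempty (Sph n) := ⟨⟨EuclideanSpace.single 0 1, by simp⟩⟩
  have key : ∀ (x : Sph n) (r : ℝ), 0 < r →
      ((deriv (deriv ρ) r / (1 + deriv ρ r ^ 2)) • sphereExtension η x +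
      ∑ a : Fin n, (1 + (ρ r / r) ^ 2 * (if (a : ℕ) < p then lam ^ 2 else 0))⁻¹ •
        ((deriv ρ r / r) • sphereExtension η x +
        (ρ r / r ^ 2) •
          fderiv ℝ (fderiv ℝ (sphereExtension η)) x (v x a) (v x a)) = 0 ↔
      deriv (deriv ρ) r / (1 + deriv ρ r ^ 2)
              + ((n : ℝ) - (p : ℝ)) * deriv ρ r / r
              + (p : ℝ) * (deriv ρ r / r - lam ^ 2 * ρ r / r ^ 2)
                  / (1 + lam ^ 2 * ρ r ^ 2 / r ^ 2) = 0) := by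
    intro x r hr
    rw [(hv x).sum_weighted_eq_of_link hh hl hl0 hs (hlink x _ _ (hv x)), ← add_smul,
      smul_eq_zero, or_iff_left (norm_ne_zero_iff.1 (by
        rw [hh.norm_eq x x.coe_ne_zero]; exact one_ne_zero)),
      sum_fin_ite_lt (fun s => (1 + (ρ r / r) ^ 2 * s)⁻¹ * (deriv ρ r / r - ρ r / r ^ 2 * s)) hpn]
    have h1 : 1 + (ρ r / r) ^ 2 * lam ^ 2 = 1 + lam ^ 2 * ρ r ^ 2 / r ^ 2 := by
      rw [div_pow]; ring
    rw [h1]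
    simp only [mul_zero, add_zero, inv_one, one_mul, sub_zero]
    rw [show ∀ A B C : ℝ, A + (B + C) = A + C + B from fun A B C => by ring]
    rw [show ρ r / r ^ 2 * lam ^ 2 = lam ^ 2 * ρ r / r ^ 2 by ring,
      mul_div_assoc ((n : ℝ) - p),
      mul_div_assoc (p : ℝ), div_eq_inv_mul (deriv ρ r / r - _)]
  -- The scalar equation does not involve `x`, so a single point of the sphere suffices in one
  -- direction.
  exact ⟨fun h r hr => (key x₀ r hr).1 (h x₀ r hr), fun h x r hr => (key x r hr).2 (h r hr)⟩
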